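/- Let $N_1,N_2\ge 2$ be integers, let $(p_{i,1},\dots,p_{i,N_i})$, $i=1,2$, be probability vectors with positive entries, and put $q_{i,j}=\sum_{\ell<j}p_{i,\ell}$. Let $\mathcal D\subset\{1,\dots,N_1\}\times\{1,\dots,N_2\}$ with $1<|\mathcal D|<N_1N_2$. For $w=(j_1,j_2)\in\mathcal D$ let $\psi_w(x_1,x_2)=(p_{1,j_1}x_1+q_{1,j_1},\,p_{2,j_2}x_2+q_{2,j_2})$, and let the Barański carpet $K=K(\Psi_{\mathcal D})$ be the attractor of $\Psi_{\mathcal D}=\{\psi_w:w\in\mathcal D\}$, i.e. the unique non-empty compact set $K\subset\mathbb R^2$ with $K=\bigcup_{w\in\mathcal D}\psi_w(K)$. For $k\ge1$ the $k$-th Hata graph $\Gamma_k$ has vertex set $\mathcal D^k$, and distinct words $\mathbf i,\mathbf j\in\mathcal D^k$ are joined by an edge if and only if $\psi_{\mathbf i}(K)\cap\psi_{\mathbf j}(K)\ne\varnothing$, where $\psi_{\mathbf i}=\psi_{i_1}\circ\cdots\circ\psi_{i_k}$ for $\mathbf i=i_1\cdots i_k$. A vertex $v$ of a connected finite graph $G$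 is a cut vertex if $G-\{v\}$ is disconnected; in that case let $|G_2(v)|$ be the number of vertices of the second largest connected component of $G-\{v\}$ (that is, the second entry of the list of component sizes in non-increasing order, with multiplicity). Put $\chi(G)=\max\{|G_2(v)| : v\text{ a cut vertex of }G\}$ if $G$ has cut vertices and $\chi(G)=0$ otherwise. A point $x\in K$ is a cut point of $K$ if $K\setminus\{x\}$ is not connected. **Theorem.** Suppose that $K=K(\Psi_{\mathcal D})$ is connected. Then $K$ has a cut point if and only if $\chi(\Gamma_k)\ge|\mathcal D|^{k-1}-1$ for all $k\ge2$. -/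

import Mathlib

/-! ### Attractors of iterated function systems -/

/-- `K` is an attractor of the family `f`: it is compact, non-empty and `K = ⋃ i, f i (K)`. -/
def IsAttractor {ι X : Type*} [TopologicalSpace X] (f : ι → X → X) (K : Set X) : Prop :=
  IsCompact K ∧ K.Nonempty ∧ K = ⋃ i, f i '' K

theorem hausdorffEDist_image_le_mul {X : Type*} [MetricSpace X] {c : NNReal} {g : X → X}
    (hg : LipschitzWith c g) {s t : Set X} (hs : IsCompact s) (ht : IsCompact t)
    (hs' : s.Nonempty) (ht' : t.Nonempty) :
    Metric.hausdorffEDist (g '' s) (g '' t) ≤ c * Metric.hausdorffEDist s t := by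
  apply Metric.hausdorffEDist_le_of_infEDist
  · rintro _ ⟨x, hx, rfl⟩
    obtain ⟨y, hy, hxy⟩ := ht.exists_infEDist_eq_edist ht' x
    calc Metric.infEDist (g x) (g '' t) ≤ edist (g x) (g y) :=
          Metric.infEDist_le_edist_of_mem (Set.mem_image_of_mem g hy)
      _ ≤ c * edist x y := hg x y
      _ ≤ c * Metric.hausdorffEDist s t := by
          gcongr
          rw [← hxy]
          exact Metric.infEDist_le_hausdorffEDist_of_mem hx
  · rintro _ ⟨x, hx, rfl⟩
    obtain ⟨y, hy, hxy⟩ := hs.exists_infEDist_eq_edist hs' x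
    calc Metric.infEDist (g x) (g '' s) ≤ edist (g x) (g y) :=
          Metric.infEDist_le_edist_of_mem (Set.mem_image_of_mem g hy)
      _ ≤ c * edist x y := hg x y
      _ ≤ c * Metric.hausdorffEDist s t := by
          gcongr
          rw [← hxy, Metric.hausdorffEDist_comm]
          exact Metric.infEDist_le_hausdorffEDist_of_mem hx

/-- Hutchinson's theorem: a finite non-empty family of contractions of a complete metric space
has exactly one attractor. -/
theorem existsUnique_isAttractor {ι X : Type*} [Finite ι] [Nonempty ι] [MetricSpace X]
    [CompleteSpace X] [Nonempty X] (f : ι → X → X) (c : NNReal) (hc : c < 1)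
    (hf : ∀ i, LipschitzWith c (f i)) : ∃! K : Set X, IsAttractor f K := by
  let T : TopologicalSpace.NonemptyCompacts X → TopologicalSpace.NonemptyCompacts X := fun K =>
    ⟨⟨⋃ i, f i '' (K : Set X),
      isCompact_iUnion fun i => K.isCompact.image (hf i).continuous⟩,
      Set.nonempty_iUnion.2 ⟨Classical.arbitrary ι, K.nonempty.image _⟩⟩
  have hT : ContractingWith c T := by
    refine ⟨hc, fun K L => ?_⟩
    change Metric.hausdorffEDist (⋃ i, f i '' (K : Set X)) (⋃ i, f i '' (L : Set X)) ≤
      c * Metric.hausdorffEDist (K : Set X) L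
    refine Metric.hausdorffEDist_iUnion_le.trans (iSup_le fun i => ?_)
    exact hausdorffEDist_image_le_mul (hf i) K.isCompact L.isCompact K.nonempty L.nonempty
  have : Nonempty (TopologicalSpace.NonemptyCompacts X) :=
    ⟨⟨⟨{Classical.arbitrary X}, isCompact_singleton⟩, Set.singleton_nonempty _⟩⟩
  let K₀ := hT.fixedPoint T
  have hK₀ : T K₀ = K₀ := hT.fixedPoint_isFixedPt
  refine ⟨(K₀ : Set X), ⟨K₀.isCompact, K₀.nonempty, ?_⟩, ?_⟩
  · exact (congrArg (fun K : TopologicalSpace.NonemptyCompacts X => (K : Set X)) hK₀).symm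
  · rintro L ⟨hLc, hLn, hL⟩
    let L' : TopologicalSpace.NonemptyCompacts X := ⟨⟨L, hLc⟩, hLn⟩
    have hL' : T L' = L' := by
      apply TopologicalSpace.NonemptyCompacts.ext
      exact hL.symm
    have := hT.fixedPoint_unique' hL' hK₀
    exact congrArg (fun K : TopologicalSpace.NonemptyCompacts X => (K : Set X)) this

/-! ### Barański carpets -/

/-- The data of a Barański carpet: integers `N₁, N₂ ≥ 2`, probability vectors `p₁, p₂` of lengths
`N₁, N₂` with positive entries (indexed from `0`), and a digit set `D` of pairs of indices with
`1 < |D| < N₁ N₂`. -/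
structure BaranskiData where
  N₁ : ℕ
  N₂ : ℕ
  two_le_N₁ : 2 ≤ N₁
  two_le_N₂ : 2 ≤ N₂
  p₁ : Fin N₁ → ℝ
  p₂ : Fin N₂ → ℝ
  p₁_pos : ∀ j, 0 < p₁ j
  p₂_pos : ∀ j, 0 < p₂ j
  sum_p₁ : ∑ j, p₁ j = 1
  sum_p₂ : ∑ j, p₂ j = 1
  D : Finset (Fin N₁ × Fin N₂)
  one_lt_card : 1 < D.card
  card_lt : D.card < N₁ * N₂

namespace BaranskiData

/-- The translation `q_j = ∑_{ℓ < j} p_ℓ`. -/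
noncomputable def offset {N : ℕ} (p : Fin N → ℝ) (j : Fin N) : ℝ := ∑ l ∈ Finset.Iio j, p l

/-- The affine map `ψ_w (x, y) = (p_{1,j₁} x + q_{1,j₁}, p_{2,j₂} y + q_{2,j₂})`, `w = (j₁, j₂)`. -/
noncomputable def psi (B : BaranskiData) (w : B.D) (x : ℝ × ℝ) : ℝ × ℝ :=
  (B.p₁ w.1.1 * x.1 + offset B.p₁ w.1.1, B.p₂ w.1.2 * x.2 + offset B.p₂ w.1.2)

theorem lt_one_of_sum {N : ℕ} (hN : 2 ≤ N) (p : Fin N → ℝ) (hp : ∀ j, 0 < p j)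
    (hs : ∑ j, p j = 1) (j : Fin N) : p j < 1 := by
  have : Nontrivial (Fin N) := Fin.nontrivial_iff_two_le.2 hN
  obtain ⟨i, hi⟩ := exists_ne j
  calc p j < ∑ l, p l := Finset.single_lt_sum hi (Finset.mem_univ j) (Finset.mem_univ i) (hp i)
        (fun l _ _ => (hp l).le)
    _ = 1 := hs

theorem lipschitzWith_affine {a b : ℝ} {c : NNReal} (ha : 0 < a) (hac : a ≤ c) :
    LipschitzWith c (fun x : ℝ => a * x + b) := by
  refine LipschitzWith.of_dist_le_mul fun x y => ?_
  rw [Real.dist_eq, Real.dist_eq, show a * x + b - (a * y + b) = a * (x - y) by ring, abs_mul,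
    abs_of_pos ha]
  gcongr

theorem existsUnique_carpet (B : BaranskiData) : ∃! K : Set (ℝ × ℝ), IsAttractor B.psi K := by
  have : Nonempty B.D := (Finset.card_pos.1 (by have := B.one_lt_card; omega)).to_subtype
  have hlt : ∀ w : B.D, max (B.p₁ w.1.1) (B.p₂ w.1.2) < 1 := fun w =>
    max_lt (lt_one_of_sum B.two_le_N₁ _ B.p₁_pos B.sum_p₁ _)
      (lt_one_of_sum B.two_le_N₂ _ B.p₂_pos B.sum_p₂ _)
  obtain ⟨w₀, hw₀⟩ := Finite.exists_max fun w : B.D => max (B.p₁ w.1.1) (B.p₂ w.1.2)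
  have h0 : 0 ≤ max (B.p₁ w₀.1.1) (B.p₂ w₀.1.2) := le_max_of_le_left (B.p₁_pos _).le
  obtain ⟨c, hc⟩ : ∃ c : NNReal, (c : ℝ) = max (B.p₁ w₀.1.1) (B.p₂ w₀.1.2) := ⟨⟨_, h0⟩, rfl⟩
  refine existsUnique_isAttractor B.psi c (by exact_mod_cast hc ▸ hlt w₀) fun w => ?_
  have h₁ : LipschitzWith c fun x : ℝ => B.p₁ w.1.1 * x + offset B.p₁ w.1.1 :=
    lipschitzWith_affine (B.p₁_pos _) (hc ▸ (le_max_left _ _).trans (hw₀ w))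
  have h₂ : LipschitzWith c fun x : ℝ => B.p₂ w.1.2 * x + offset B.p₂ w.1.2 :=
    lipschitzWith_affine (B.p₂_pos _) (hc ▸ (le_max_right _ _).trans (hw₀ w))
  have h := (h₁.comp LipschitzWith.prod_fst).prodMk (h₂.comp LipschitzWith.prod_snd)
  rw [mul_one, max_self] at h
  exact h

/-- The Barański carpet `K(Ψ_D)`, the attractor of the maps `ψ_w`, `w ∈ D`. -/
noncomputable def carpet (B : BaranskiData) : Set (ℝ × ℝ) := B.existsUnique_carpet.exists.choose

theorem isAttractor_carpet (B : BaranskiData) : IsAttractor B.psi B.carpet :=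
  B.existsUnique_carpet.exists.choose_spec

/-- `ψ_u = ψ_{u_1} ∘ ⋯ ∘ ψ_{u_k}` for a word `u = u_1 ⋯ u_k` over `D`. -/
noncomputable def psiWord (B : BaranskiData) : (k : ℕ) → (Fin k → B.D) → ℝ × ℝ → ℝ × ℝ
  | 0, _ => id
  | k + 1, u => B.psi (u 0) ∘ B.psiWord k (Fin.tail u)

/-- The `k`-th Hata graph `Γ_k`: its vertices are the words of length `k` over `D`, and distinct
words `u, v` are joined if and only if `ψ_u(K)` and `ψ_v(K)` meet. -/
def hataGraph (B : BaranskiData) (k : ℕ) : SimpleGraph (Fin k → B.D) where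
  Adj u v := u ≠ v ∧ (B.psiWord k u '' B.carpet ∩ B.psiWord k v '' B.carpet).Nonempty
  symm := ⟨fun _ _ h => ⟨h.1.symm, by rw [Set.inter_comm]; exact h.2⟩⟩
  loopless := ⟨fun _ h => h.1 rfl⟩

end BaranskiData

/-! ### Cut points, cut vertices and `χ` -/

/-- `x` is a cut point of the set `K`: removing it from `K` leaves a disconnected set. -/
def IsCutPoint {X : Type*} [TopologicalSpace X] (K : Set X) (x : X) : Prop :=
  x ∈ K ∧ ¬ IsPreconnected (K \ {x})

namespace SimpleGraph

variable {V : Type*}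

/-- The graph `G - {v}`. -/
abbrev deleteVertex (G : SimpleGraph V) (v : V) : SimpleGraph ({v}ᶜ : Set V) := G.induce {v}ᶜ

/-- `v` is a cut vertex of `G`: the graph `G - {v}` is disconnected. -/
def IsCutVertex (G : SimpleGraph V) (v : V) : Prop := ¬ (G.deleteVertex v).Preconnected

open scoped Classical in
/-- The numbers of vertices of the connected components of `G`, listed (with multiplicity) in
decreasing order. -/
noncomputable def componentSizes [Fintype V] (G : SimpleGraph V) : List ℕ :=
  ((Finset.univ : Finset G.ConnectedComponent).val.map fun C => C.supp.ncard).sort (· ≥ ·)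

open scoped Classical in
/-- The number `χ(G)`: the maximum, over all cut vertices `v` of `G`, of the number of vertices
of the second largest connected component of `G - {v}` (the entry of index `1` of the
decreasing list of component sizes); it is `0` if there are no cut vertices. -/
noncomputable def chi [Fintype V] (G : SimpleGraph V) : ℕ :=
  (Finset.univ.filter fun v => G.IsCutVertex v).sup fun v =>
    (G.deleteVertex v).componentSizes.getD 1 0

end SimpleGraph

/-! How cells meet is controlled by the boundary of `K`: row neighbours meet exactly at the heights
`t` with `(0,t)` and `(1,t)` both in `K` (`Facing t`), column neighbours symmetrically, and diagonal
neighbours only at a corner. `CarpetSystem` keeps just this information, and `swap` lets one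
argument serve both axes.

From a cut point to large components there are two cases. In the first, the first-level cells have a
partition whose parts meet in a single point (`Pinched`). On one part only one cell `v` contains
this point (`Pinched.exists_unique_cell`), and seen from `v` the point is so special that it has
only one address (`Tame.step`). Removing the word formed by `v` and this address separates the
parts; if the part of `v` has a second cell, two whole blocks of `|D|^k` words are separated
(`le_chi_of_pinchedAt`). If it has not, either another pinched partition works, or the address is
constant `e e e ⋯` and the block of `v` without the removed word stays in one component
(`le_chi_of_isTail`); the lost word accounts for the `-1` of the theorem.

In the second case there is no pinched partition. Write `K` as the union of closed sets `E`, `F`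
meeting only in the cut point, chosen with as many coordinates in `{0,1}` as possible. Then the cut
point lies in a single cell, that cell is again split, and this repeats at all levels, so each level
has one word whose removal separates `E` from `F`. If each of `E`, `F` contains a further
first-level cell, whole blocks are separated (`le_chi_of_balanced`). If this never happened, the
side of the other cells would have to change infinitely often along the address of the cut point; a
change forces all contacts of a cell `a` into one subcell `b` (`Confined`), and the geometry of
facing pairs forbids that `b` is confined as well (`exists_balanced`).

Conversely, let the cut vertices of `Γ_k` have two large components for every `k`. Each component
contains all words with some two-letter prefix. Along an ultrafilter these prefixes become constant
and the cylinders of the cut vertices shrink to a point `x`; the limit of the components is locally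
constant on `K \ {x}` and separates two nonempty pieces (`exists_isCutPoint_of_le_chi`). -/

/-! ### Sides of an interval and grid axes -/

/-- The two endpoints of the unit interval, indexed by `Bool`. -/
def side (σ : Bool) : ℝ := if σ then 1 else 0

theorem side_injective : Function.Injective side := by
  intro σ τ h
  cases σ <;> cases τ <;> simp_all [side]

theorem side_mem (σ : Bool) : side σ ∈ Set.Icc (0 : ℝ) 1 := by
  cases σ <;> simp [side]

/-- `j` is the neighbour of the index `i` on the side `σ`. -/
def IsNext (σ : Bool) (i j : ℕ) : Prop := if σ then j = i + 1 else i = j + 1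

theorem IsNext.symm {σ : Bool} {i j : ℕ} (h : IsNext σ i j) : IsNext (!σ) j i := by
  cases σ <;> simpa [IsNext] using h

theorem IsNext.ne {σ : Bool} {i j : ℕ} (h : IsNext σ i j) : i ≠ j := by
  cases σ <;> simp [IsNext] at h <;> omega

theorem IsNext.right_unique {σ : Bool} {i j k : ℕ} (h : IsNext σ i j) (h' : IsNext σ i k) :
    j = k := by
  cases σ <;> simp [IsNext] at h h' <;> omega

theorem IsNext.side_unique {σ τ : Bool} {i j : ℕ} (h : IsNext σ i j) (h' : IsNext τ i j) :
    σ = τ := by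
  cases σ <;> cases τ <;> simp [IsNext] at h h' ⊢ <;> omega

/-- One coordinate of a carpet with cells `D`: the unit interval is divided into `last + 1`
intervals, the cell `w` projects to the interval number `idx w`, and `g w` is the contraction of
the unit interval onto that interval. -/
structure GridAxis (D : Type*) where
  last : ℕ
  one_le_last : 1 ≤ last
  idx : D → ℕ
  idx_le : ∀ w, idx w ≤ last
  g : D → ℝ → ℝ
  g_congr : ∀ {v w}, idx v = idx w → g v = g w
  g_contract : ∀ w, ∃ r : ℝ, 0 < r ∧ r < 1 ∧ ∀ s t, |g w s - g w t| = r * |s - t|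
  glue : ∀ {σ v w}, IsNext σ (idx v) (idx w) → g v (side σ) = g w (side !σ)
  meet : ∀ {v w s t}, s ∈ Set.Icc (0 : ℝ) 1 → t ∈ Set.Icc (0 : ℝ) 1 → g v s = g w t →
    (idx v = idx w ∧ s = t) ∨ ∃ σ, IsNext σ (idx v) (idx w) ∧ s = side σ ∧ t = side !σ
  g_end : ∀ {σ : Bool} {w}, idx w = (if σ then last else 0) → g w (side σ) = side σ
  end_of : ∀ {σ : Bool} {w s}, s ∈ Set.Icc (0 : ℝ) 1 → g w s = side σ →
    idx w = (if σ then last else 0) ∧ s = side σ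

namespace GridAxis

variable {D : Type*} (A : GridAxis D)

/-- The extreme index on the side `σ`. -/
def ext (σ : Bool) : ℕ := if σ then A.last else 0

theorem ext_injective : Function.Injective A.ext := by
  have := A.one_le_last
  intro σ τ h
  cases σ <;> cases τ <;> simp [ext] at h ⊢ <;> omega

theorem g_ext {σ : Bool} {w : D} (h : A.idx w = A.ext σ) : A.g w (side σ) = side σ := A.g_end h

theorem eq_side_of_g {σ : Bool} {w : D} {s : ℝ} (hs : s ∈ Set.Icc (0 : ℝ) 1)
    (h : A.g w s = side σ) : A.idx w = A.ext σ ∧ s = side σ := A.end_of hs h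

theorem side_of_isNext_ext {σ τ : Bool} {v w : D} (hv : A.idx v = A.ext σ)
    (h : IsNext τ (A.idx v) (A.idx w)) : τ = !σ := by
  have := A.idx_le w
  rw [hv] at h
  cases σ <;> cases τ <;> simp [ext, IsNext] at h ⊢ <;> omega

theorem g_injective (w : D) : Function.Injective (A.g w) := by
  obtain ⟨r, hr, -, h⟩ := A.g_contract w
  intro s t hst
  have := h s t
  rw [hst, sub_self, abs_zero, eq_comm, mul_eq_zero] at this
  rcases this with h0 | h0
  · exact absurd h0 hr.ne'
  · exact sub_eq_zero.1 (abs_eq_zero.1 h0)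

theorem fixed_unique {w : D} {s t : ℝ} (hs : A.g w s = s) (ht : A.g w t = t) : s = t := by
  obtain ⟨r, -, hr, h⟩ := A.g_contract w
  have := h s t
  rw [hs, ht] at this
  have h0 : |s - t| = 0 := by nlinarith [abs_nonneg (s - t)]
  exact sub_eq_zero.1 (abs_eq_zero.1 h0)

theorem eq_of_meet_of_idx {v w : D} {s t : ℝ} (hs : s ∈ Set.Icc (0 : ℝ) 1)
    (ht : t ∈ Set.Icc (0 : ℝ) 1) (h : A.g v s = A.g w t) (hvw : A.idx v = A.idx w) : s = t := by
  rcases A.meet hs ht h with h | ⟨σ, h, -⟩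
  · exact h.2
  · exact absurd hvw h.ne

/-- An inner grid point is not an endpoint. -/
theorem g_ne_side {σ ρ : Bool} {v w : D} (h : IsNext σ (A.idx v) (A.idx w)) :
    A.g v (side σ) ≠ side ρ := by
  intro h0
  have h1 := (A.eq_side_of_g (side_mem _) h0).2
  have h2 := (A.eq_side_of_g (side_mem _) ((A.glue h).symm.trans h0)).2
  have := side_injective (h1.trans h2.symm)
  cases σ <;> simp at this

/-- A set that lies in its own image under `g w` contains at most the fixed point of `g w`. -/
theorem eq_fixed_of_self_subset {F : ℝ → Prop} {w : D} {u : ℝ} (hu : A.g w u = u)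
    (huI : u ∈ Set.Icc (0 : ℝ) 1) (hF : ∀ t, F t → t ∈ Set.Icc (0 : ℝ) 1)
    (h : ∀ t, F t → ∃ s, F s ∧ A.g w s = t) {t : ℝ} (ht : F t) : t = u := by
  obtain ⟨r, hr0, hr, hc⟩ := A.g_contract w
  -- Every point of `F` has preimages of all orders in `F`, and each application of `g w` contracts
  -- the distance to the fixed point `u` by `r`.
  have key : ∀ n : ℕ, ∀ t, F t → |t - u| ≤ r ^ n := by
    intro n
    induction n with
    | zero =>
      intro t ht
      have := hF t ht
      rw [pow_zero, abs_le]
      constructor <;> linarith [this.1, this.2, huI.1, huI.2]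
    | succ n ih =>
      intro t ht
      obtain ⟨s, hs, rfl⟩ := h t ht
      have h1 := hc s u
      rw [hu] at h1
      rw [h1, pow_succ']
      exact mul_le_mul_of_nonneg_left (ih s hs) hr0.le
  have hlim := tendsto_pow_atTop_nhds_zero_of_lt_one hr0.le hr
  have : |t - u| ≤ 0 := ge_of_tendsto' hlim fun n => key n t ht
  exact sub_eq_zero.1 (abs_eq_zero.1 (le_antisymm this (abs_nonneg _)))

end GridAxis

/-! ### Carpet systems -/

/-- The combinatorial data of a connected carpet `K` in the plane (given as a binary predicate)
with cells `D`, in a form that is symmetric in the two coordinates. -/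
structure CarpetSystem (D : Type*) where
  X : GridAxis D
  Y : GridAxis D
  K : ℝ → ℝ → Prop
  inj : ∀ {v w}, X.idx v = X.idx w → Y.idx v = Y.idx w → v = w
  mem_left : ∀ {x y}, K x y → x ∈ Set.Icc (0 : ℝ) 1
  mem_right : ∀ {x y}, K x y → y ∈ Set.Icc (0 : ℝ) 1
  K_iff : ∀ {x y}, K x y ↔ ∃ w p q, K p q ∧ X.g w p = x ∧ Y.g w q = y
  fixed : ∀ w, ∃ p q, K p q ∧ X.g w p = p ∧ Y.g w q = q
  conn : ∀ A : Set D, A.Nonempty → Aᶜ.Nonempty → ∃ v ∈ A, ∃ w ∉ A, ∃ p q p' q',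
    K p q ∧ K p' q' ∧ X.g v p = X.g w p' ∧ Y.g v q = Y.g w q'

namespace CarpetSystem

variable {D : Type*} (S : CarpetSystem D)

/-- The system with the two coordinates exchanged. -/
def swap : CarpetSystem D where
  X := S.Y
  Y := S.X
  K x y := S.K y x
  inj h h' := S.inj h' h
  mem_left := S.mem_right
  mem_right := S.mem_left
  K_iff := by
    intro x y
    rw [S.K_iff]
    constructor
    · rintro ⟨w, p, q, h, hp, hq⟩
      exact ⟨w, q, p, h, hq, hp⟩
    · rintro ⟨w, p, q, h, hp, hq⟩
      exact ⟨w, q, p, h, hq, hp⟩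
  fixed w := by
    obtain ⟨p, q, h, hp, hq⟩ := S.fixed w
    exact ⟨q, p, h, hq, hp⟩
  conn A hA hA' := by
    obtain ⟨v, hv, w, hw, p, q, p', q', h, h', hp, hq⟩ := S.conn A hA hA'
    exact ⟨v, hv, w, hw, q, p, q', p', h, h', hq, hp⟩

/-- The point `(x, y)` lies in the image of `K` in the cell `w`. -/
def Cell (w : D) (x y : ℝ) : Prop := ∃ p q, S.K p q ∧ S.X.g w p = x ∧ S.Y.g w q = y

/-- `(p, q) ∈ K` corresponds to a point of the cell `a` that lies in another cell. -/
def Contact (a : D) (p q : ℝ) : Prop := S.K p q ∧ ∃ w, w ≠ a ∧ S.Cell w (S.X.g a p) (S.Y.g a q)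

/-- All contact points of the cell `a` lie in the subcell `b` and in no other one. -/
def Confined (a b : D) : Prop :=
  ∀ p q, S.Contact a p q → S.Cell b p q ∧ ∀ w, w ≠ b → ¬ S.Cell w p q

/-- The points `(0, t)` and `(1, t)` both lie in `K`. -/
def Facing (t : ℝ) : Prop := ∀ σ, S.K (side σ) t

theorem swap_cell {w : D} {x y : ℝ} : S.swap.Cell w y x ↔ S.Cell w x y := by
  constructor
  · rintro ⟨p, q, h, hp, hq⟩
    exact ⟨q, p, h, hq, hp⟩
  · rintro ⟨p, q, h, hp, hq⟩
    exact ⟨q, p, h, hq, hp⟩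

theorem swap_contact {a : D} {p q : ℝ} : S.swap.Contact a q p ↔ S.Contact a p q :=
  and_congr Iff.rfl (exists_congr fun _ => and_congr Iff.rfl S.swap_cell)

theorem Confined.swap {a b : D} (h : S.Confined a b) : S.swap.Confined a b := fun p q hpq =>
  ⟨S.swap_cell.2 (h q p (S.swap_contact.1 hpq)).1,
    fun w hw hc => (h q p (S.swap_contact.1 hpq)).2 w hw (S.swap_cell.1 hc)⟩

theorem exists_cell {x y : ℝ} (h : S.K x y) : ∃ w, S.Cell w x y := S.K_iff.1 h

theorem Cell.mem {w : D} {x y : ℝ} (h : S.Cell w x y) : S.K x y := S.K_iff.2 ⟨w, h⟩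

variable {S}

theorem Cell.idx_left {w : D} {σ : Bool} {y : ℝ} (h : S.Cell w (side σ) y) :
    S.X.idx w = S.X.ext σ ∧ ∃ s, S.K (side σ) s ∧ S.Y.g w s = y := by
  obtain ⟨p, q, hK, hp, hq⟩ := h
  obtain ⟨h1, rfl⟩ := S.X.eq_side_of_g (S.mem_left hK) hp
  exact ⟨h1, q, hK, hq⟩

theorem Cell.idx_right {w : D} {σ : Bool} {x : ℝ} (h : S.Cell w x (side σ)) :
    S.Y.idx w = S.Y.ext σ ∧ ∃ s, S.K s (side σ) ∧ S.X.g w s = x :=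
  Cell.idx_left (S := S.swap) (S.swap_cell.2 h)

theorem cell_of_ext {w : D} {σ : Bool} (hw : S.X.idx w = S.X.ext σ) {s : ℝ}
    (h : S.K (side σ) s) : S.Cell w (side σ) (S.Y.g w s) :=
  ⟨_, _, h, S.X.g_ext hw, rfl⟩

theorem exists_fixed_of_ext {w : D} {σ : Bool} (hw : S.X.idx w = S.X.ext σ) :
    ∃ t, S.K (side σ) t ∧ S.Y.g w t = t := by
  obtain ⟨p, q, h, hp, hq⟩ := S.fixed w
  obtain rfl := S.X.fixed_unique hp (S.X.g_ext hw)
  exact ⟨q, h, hq⟩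

theorem corner_mem {w : D} {σ τ : Bool} (hw : S.X.idx w = S.X.ext σ)
    (hw' : S.Y.idx w = S.Y.ext τ) : S.K (side σ) (side τ) := by
  obtain ⟨t, h, ht⟩ := S.exists_fixed_of_ext hw
  rwa [S.Y.fixed_unique ht (S.Y.g_ext hw')] at h

/-- Two cells in the same row at the two ends of it produce a facing pair of fixed points. -/
theorem exists_facing_fixed {v w : D} {σ : Bool} (hv : S.X.idx v = S.X.ext σ)
    (hw : S.X.idx w = S.X.ext !σ) (hvw : S.Y.idx v = S.Y.idx w) :
    ∃ t, S.Facing t ∧ S.Y.g v t = t := by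
  obtain ⟨t, h, ht⟩ := S.exists_fixed_of_ext hv
  obtain ⟨t', h', ht'⟩ := S.exists_fixed_of_ext hw
  rw [← S.Y.g_congr hvw] at ht'
  obtain rfl := S.Y.fixed_unique ht ht'
  refine ⟨t, fun ρ => ?_, ht⟩
  by_cases hρ : ρ = σ
  · rwa [hρ]
  · rwa [(Bool.eq_not.2 hρ : ρ = !σ)]

theorem facing_of {σ : Bool} {t : ℝ} (h : S.K (side σ) t) (h' : S.K (side !σ) t) :
    S.Facing t := by
  intro ρ
  by_cases hρ : ρ = σ
  · rwa [hρ]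
  · rwa [(Bool.eq_not.2 hρ : ρ = !σ)]

/-- Two cells that are neighbours in a row. -/
def RowNext (S : CarpetSystem D) (σ : Bool) (v w : D) : Prop :=
  IsNext σ (S.X.idx v) (S.X.idx w) ∧ S.Y.idx v = S.Y.idx w

theorem RowNext.symm {σ : Bool} {v w : D} (h : S.RowNext σ v w) : S.RowNext (!σ) w v :=
  ⟨h.1.symm, h.2.symm⟩

theorem RowNext.ne {σ : Bool} {v w : D} (h : S.RowNext σ v w) : v ≠ w :=
  fun e => h.1.ne (congrArg _ e)

/-- Two cells that are diagonal neighbours. -/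
def DiagNext (S : CarpetSystem D) (σ τ : Bool) (v w : D) : Prop :=
  IsNext σ (S.X.idx v) (S.X.idx w) ∧ IsNext τ (S.Y.idx v) (S.Y.idx w)

/-- The three ways in which two distinct cells can meet. -/
theorem meet_cases {v w : D} (hvw : v ≠ w) {p q p' q' : ℝ} (h : S.K p q) (h' : S.K p' q')
    (hp : S.X.g v p = S.X.g w p') (hq : S.Y.g v q = S.Y.g w q') :
    (∃ σ, S.RowNext σ v w ∧ p = side σ ∧ p' = side (!σ) ∧ q = q') ∨
    (∃ τ, S.swap.RowNext τ v w ∧ q = side τ ∧ q' = side (!τ) ∧ p = p') ∨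
    ∃ σ τ, S.DiagNext σ τ v w ∧ p = side σ ∧ p' = side (!σ) ∧ q = side τ ∧ q' = side (!τ) := by
  rcases S.X.meet (S.mem_left h) (S.mem_left h') hp with ⟨h1, h2⟩ | ⟨σ, h1, h2, h3⟩ <;>
  rcases S.Y.meet (S.mem_right h) (S.mem_right h') hq with ⟨h4, h5⟩ | ⟨τ, h4, h5, h6⟩
  · exact absurd (S.inj h1 h4) hvw
  · exact Or.inr (Or.inl ⟨τ, ⟨h4, h1⟩, h5, h6, h2⟩)
  · exact Or.inl ⟨σ, ⟨h1, h4⟩, h2, h3, h5⟩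
  · exact Or.inr (Or.inr ⟨σ, τ, ⟨h1, h4⟩, h2, h3, h5, h6⟩)

theorem Contact.cases {a : D} {p q : ℝ} (h : S.Contact a p q) :
    (∃ σ w, S.RowNext σ a w ∧ p = side σ ∧ S.Facing q) ∨
    (∃ τ w, S.swap.RowNext τ a w ∧ q = side τ ∧ S.swap.Facing p) ∨
    ∃ σ τ w, S.DiagNext σ τ a w ∧ p = side σ ∧ q = side τ := by
  obtain ⟨hK, w, hw, p', q', h', hp, hq⟩ := h
  rcases meet_cases hw.symm hK h' hp.symm hq.symm with
    ⟨σ, h1, rfl, rfl, rfl⟩ | ⟨τ, h1, rfl, rfl, rfl⟩ | ⟨σ, τ, h1, rfl, rfl, rfl, rfl⟩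
  · exact Or.inl ⟨σ, w, h1, rfl, facing_of hK h'⟩
  · exact Or.inr (Or.inl ⟨τ, w, h1, rfl, facing_of (S := S.swap) hK h'⟩)
  · exact Or.inr (Or.inr ⟨σ, τ, w, h1, rfl, rfl⟩)

theorem RowNext.contact {σ : Bool} {v w : D} (h : S.RowNext σ v w) {t : ℝ} (ht : S.Facing t) :
    S.Contact v (side σ) t :=
  ⟨ht σ, w, h.ne.symm, _, _, ht (!σ), (S.X.glue h.1).symm, by rw [S.Y.g_congr h.2]⟩

/-! ### Confined cells -/

/-- The cell holding the opposite point either lies in the same end row, and is then a corner cell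
itself, or lies one row further in, and then meets this height with its own corner. In both cases
the corner opposite to that of `b` is in `K`. -/
theorem facing_corner {b : D} {σ τ : Bool} (hb : S.X.idx b = S.X.ext σ)
    (hb' : S.Y.idx b = S.Y.ext τ) {t : ℝ} (ht : S.Facing t) (hc : S.Cell b (side σ) t) :
    S.Facing (side τ) := by
  refine facing_of (corner_mem hb hb') ?_
  obtain ⟨-, s, hs, hst⟩ := hc.idx_left
  obtain ⟨w, hw⟩ := S.exists_cell (ht !σ)
  obtain ⟨hwi, s', hs', hst'⟩ := hw.idx_left
  rcases S.Y.meet (S.mem_right hs) (S.mem_right hs') (hst.trans hst'.symm) with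
    ⟨h1, -⟩ | ⟨ρ, h1, -, rfl⟩
  · exact corner_mem hwi (h1.symm.trans hb')
  · obtain rfl := S.Y.side_of_isNext_ext hb' h1
    simpa using hs'

/-- A confined cell with two contact points has a row or column neighbour with which it has
two contact points. -/
theorem Confined.exists_facing {a b : D} (hab : S.Confined a b) {p q p' q' : ℝ}
    (h : S.Contact a p q) (h' : S.Contact a p' q') (hne : ¬ (p = p' ∧ q = q')) :
    (∃ σ w, S.RowNext σ a w ∧ ∃ t t', S.Facing t ∧ S.Facing t' ∧ t ≠ t') ∨
    (∃ σ w, S.swap.RowNext σ a w ∧ ∃ t t', S.swap.Facing t ∧ S.swap.Facing t' ∧ t ≠ t') := by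
  by_contra! hcon
  obtain ⟨hX, hY⟩ := hcon
  apply hne
  have hc := (hab _ _ h).1
  have hc' := (hab _ _ h').1
  -- A contact across a row puts `b` into an end column. If `b` also lies in an end row, the corner
  -- is a second facing value, so uniqueness moves the contact to the corner. Two contacts of
  -- different kinds therefore coincide.
  have row : ∀ {σ τ w q}, S.RowNext σ a w → S.Facing q → S.Contact a (side σ) q →
      S.Y.idx b = S.Y.ext τ → q = side τ := by
    intro σ τ w q h1 h2 h3 h4
    have h5 := (hab _ _ h3).1
    exact hX σ w h1 _ _ h2 (facing_corner h5.idx_left.1 h4 h2 h5)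
  have col : ∀ {σ τ w p}, S.swap.RowNext τ a w → S.swap.Facing p → S.Contact a p (side τ) →
      S.X.idx b = S.X.ext σ → p = side σ := by
    intro σ τ w p h1 h2 h3 h4
    have h5 := (hab _ _ h3).1
    exact hY τ w h1 _ _ h2
      (facing_corner (S := S.swap) h5.idx_right.1 h4 h2 (S.swap_cell.2 h5))
  have ex : ∀ {σ σ' y y'}, S.Cell b (side σ) y → S.Cell b (side σ') y' → side σ = side σ' :=
    fun h1 h2 => congrArg side (S.X.ext_injective (h1.idx_left.1.symm.trans h2.idx_left.1))
  have ey : ∀ {σ σ' x x'}, S.Cell b x (side σ) → S.Cell b x' (side σ') → side σ = side σ' :=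
    fun h1 h2 => congrArg side (S.Y.ext_injective (h1.idx_right.1.symm.trans h2.idx_right.1))
  rcases h.cases with ⟨σ, w, h1, rfl, h2⟩ | ⟨τ, w, h1, rfl, h2⟩ | ⟨σ, τ, w, h1, rfl, rfl⟩ <;>
  rcases h'.cases with ⟨σ', w', h1', rfl, h2'⟩ | ⟨τ', w', h1', rfl, h2'⟩ |
    ⟨σ', τ', w', h1', rfl, rfl⟩
  · exact ⟨ex hc hc', hX _ _ h1 _ _ h2 h2'⟩
  · exact ⟨(col h1' h2' h' hc.idx_left.1).symm, row h1 h2 h hc'.idx_right.1⟩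
  · exact ⟨ex hc hc', row h1 h2 h hc'.idx_right.1⟩
  · exact ⟨col h1 h2 h hc'.idx_left.1, (row h1' h2' h' hc.idx_right.1).symm⟩
  · exact ⟨hY _ _ h1 _ _ h2 h2', ey hc hc'⟩
  · exact ⟨col h1 h2 h hc'.idx_left.1, ey hc hc'⟩
  · exact ⟨ex hc hc', (row h1' h2' h' hc.idx_right.1).symm⟩
  · exact ⟨(col h1' h2' h' hc.idx_left.1).symm, ey hc hc'⟩
  · exact ⟨ex hc hc', ey hc hc'⟩

/-- If the row of `b` had no cell at the opposite end, every facing height would be an endpoint of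
the interval of `b`. Two such heights use both endpoints and bring all four corners into `K`; then
both heights 0 and 1 are facing, and `b` would have to lie in both end rows. -/
theorem Confined.exists_opposite {a b w₀ : D} {σ : Bool} (hab : S.Confined a b)
    (hn : S.RowNext σ a w₀) {t t' : ℝ} (ht : S.Facing t) (ht' : S.Facing t') (hne : t ≠ t') :
    S.X.idx b = S.X.ext σ ∧ ∃ c, S.X.idx c = S.X.ext (!σ) ∧ S.Y.idx b = S.Y.idx c := by
  have hcell : ∀ {t}, S.Facing t → S.Cell b (side σ) t := fun h => (hab _ _ (hn.contact h)).1
  have honly : ∀ {t w}, S.Facing t → S.Cell w (side σ) t → w = b := fun {t w} h hw => by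
    by_contra hwb
    exact (hab _ _ (hn.contact h)).2 w hwb hw
  have hb := (hcell ht).idx_left.1
  refine ⟨hb, ?_⟩
  by_contra hno
  push Not at hno
  have key : ∀ {t}, S.Facing t → ∃ ρ, t = S.Y.g b (side ρ) ∧ S.K (side σ) (side ρ) ∧
      S.K (side !σ) (side !ρ) := by
    intro t ht
    obtain ⟨-, s, hs, hst⟩ := (hcell ht).idx_left
    obtain ⟨w, hw⟩ := S.exists_cell (ht !σ)
    obtain ⟨hwi, s', hs', hst'⟩ := hw.idx_left
    rcases S.Y.meet (S.mem_right hs) (S.mem_right hs') (hst.trans hst'.symm) with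
      ⟨h1, -⟩ | ⟨ρ, h1, rfl, rfl⟩
    · exact absurd h1 (hno w hwi)
    · exact ⟨ρ, hst.symm, hs, hs'⟩
  obtain ⟨ρ, e, h1, h2⟩ := key ht
  obtain ⟨ρ', e', h1', h2'⟩ := key ht'
  have hρ : ρ' = !ρ := Bool.eq_not.2 fun h => hne (by rw [e, e', h])
  subst hρ
  have f1 : S.Facing (side ρ) := facing_of h1 (by simpa using h2')
  have f2 : S.Facing (side !ρ) := facing_of h1' h2
  have e1 := (hcell f1).idx_right.1
  have e2 := (hcell f2).idx_right.1
  have := S.Y.ext_injective (e1.symm.trans e2)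
  cases ρ <;> simp at this

/-- A confined cell `a` with two contact points in its row is confined to a cell `b` whose fixed
point is a contact point of `a`. -/
theorem Confined.exists_fixed_contact {a b w₀ : D} {σ : Bool} (hab : S.Confined a b)
    (hn : S.RowNext σ a w₀) {t t' : ℝ} (ht : S.Facing t) (ht' : S.Facing t') (hne : t ≠ t') :
    ∃ p q, S.Contact a p q ∧ S.X.g b p = p ∧ S.Y.g b q = q := by
  obtain ⟨hb, c, hc, hbc⟩ := hab.exists_opposite hn ht ht' hne
  obtain ⟨u, hu, hbu⟩ := exists_facing_fixed hb hc hbc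
  exact ⟨side σ, u, hn.contact hu, S.X.g_ext hb, hbu⟩

/-- If a confined cell `a` with two contact points in its row is confined to `b`, and `b` is
confined as well, then `b` has only one contact point. -/
theorem Confined.subsingleton_contact {a b b' w₀ : D} {σ : Bool} (hab : S.Confined a b)
    (hn : S.RowNext σ a w₀) {t t' : ℝ} (ht : S.Facing t) (ht' : S.Facing t') (hne : t ≠ t')
    (hbb : S.Confined b b') {p q p' q' : ℝ} (h : S.Contact b p q) (h' : S.Contact b p' q') :
    p = p' ∧ q = q' := by
  obtain ⟨hb, c, hc, hbc⟩ := hab.exists_opposite hn ht ht' hne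
  obtain ⟨u, hu, hbu⟩ := exists_facing_fixed hb hc hbc
  have hcell : ∀ {t}, S.Facing t → S.Cell b (side σ) t := fun h => (hab _ _ (hn.contact h)).1
  have honly : ∀ {t w}, S.Facing t → S.Cell w (side σ) t → w = b := fun {t w} h hw => by
    by_contra hwb
    exact (hab _ _ (hn.contact h)).2 w hwb hw
  -- Otherwise the set of facing heights lies in its own image under a contraction and is a single
  -- point, against `t ≠ t'`.
  have hsing : ¬ ∀ t, S.Facing t → ∃ s, S.Facing s ∧ S.Y.g b s = t := fun hall =>
    hne ((S.Y.eq_fixed_of_self_subset hbu (S.mem_right (hu true))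
      (fun t h => S.mem_right (h true)) hall ht).trans
      (S.Y.eq_fixed_of_self_subset hbu (S.mem_right (hu true))
      (fun t h => S.mem_right (h true)) hall ht').symm)
  -- A row neighbour makes the opposite points of all facing pairs contacts of `b`. The fixed height
  -- forces `b' = c`, so all facing heights come from the common row of `b` and `c`, which `hsing`
  -- excludes.
  have norow : ∀ {ρ w}, ¬ S.RowNext ρ b w := by
    intro ρ w hw
    obtain rfl := S.X.side_of_isNext_ext hb hw.1
    have hcu : S.Cell c (side !σ) u := by
      have := cell_of_ext hc (hu !σ)
      rwa [← S.Y.g_congr hbc, hbu] at this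
    obtain rfl : c = b' := by
      by_contra hcb
      exact (hbb _ _ (hw.contact hu)).2 c hcb hcu
    refine hsing fun t ht => ?_
    obtain ⟨-, s, hs, hst⟩ := (hcell ht).idx_left
    obtain ⟨-, s', hs', hst'⟩ := (hbb _ _ (hw.contact ht)).1.idx_left
    obtain rfl := S.Y.eq_of_meet_of_idx (S.mem_right hs) (S.mem_right hs')
      (hst.trans hst'.symm) hbc
    exact ⟨s, facing_of hs hs', hst⟩
  -- A facing height not coming from this row must be an endpoint of the interval of `b`, shared
  -- with an opposite cell `c'`. Depending on the side, either `w` and `c'` have a facing fixed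
  -- point in their common row, or the grid height between `b` and `w` is facing; both give a
  -- contact of `a` outside `b`.
  have nocol : ∀ {τ w}, ¬ S.swap.RowNext τ b w := by
    rintro τ w ⟨hw, hw'⟩
    change IsNext τ (S.Y.idx b) (S.Y.idx w) at hw
    change S.X.idx b = S.X.idx w at hw'
    have hwb : w ≠ b := fun e => hw.ne (by rw [e])
    push Not at hsing
    obtain ⟨t, ht, hts⟩ := hsing
    obtain ⟨-, s, hs, hst⟩ := (hcell ht).idx_left
    obtain ⟨c', hc'⟩ := S.exists_cell (ht !σ)
    obtain ⟨hci, s', hs', hst'⟩ := hc'.idx_left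
    rcases S.Y.meet (S.mem_right hs) (S.mem_right hs') (hst.trans hst'.symm) with
      ⟨h1, rfl⟩ | ⟨ρ, h1, rfl, rfl⟩
    · exact hts s (facing_of hs hs') hst
    · by_cases hτ : τ = ρ
      · subst hτ
        have e := hw.right_unique h1
        obtain ⟨x, hx, hwx⟩ := exists_facing_fixed (hw'.symm.trans hb) hci e
        refine hwb (honly hx ?_)
        have := cell_of_ext (hw'.symm.trans hb) (hx σ)
        rwa [hwx] at this
      · obtain rfl := Bool.eq_not.2 hτ
        have e := S.Y.glue hw
        have c1 : S.Cell w (side σ) (S.Y.g b (side !ρ)) := by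
          have := cell_of_ext (hw'.symm.trans hb) hs
          rw [e]
          simpa using this
        have c2 : S.Cell c (side !σ) (S.Y.g b (side !ρ)) := by
          have := cell_of_ext hc hs'
          rwa [← S.Y.g_congr hbc] at this
        exact hwb (honly (facing_of (Cell.mem S c1) (Cell.mem S c2)) c1)
  rcases h.cases with ⟨_, _, h1, -⟩ | ⟨_, _, h1, -⟩ | ⟨ρ, τ, w, h1, rfl, rfl⟩
  · exact absurd h1 norow
  · exact absurd h1 nocol
  rcases h'.cases with ⟨_, _, h1', -⟩ | ⟨_, _, h1', -⟩ | ⟨ρ', τ', w', h1', rfl, rfl⟩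
  · exact absurd h1' norow
  · exact absurd h1' nocol
  -- Only diagonal contacts remain. They are corners of `K`, and the single cell `b'` lies at a
  -- single corner.
  have c1 := (hbb _ _ h).1
  have c2 := (hbb _ _ h').1
  exact ⟨congrArg side (S.X.ext_injective (c1.idx_left.1.symm.trans c2.idx_left.1)),
    congrArg side (S.Y.ext_injective (c1.idx_right.1.symm.trans c2.idx_right.1))⟩

end CarpetSystem

namespace CarpetSystem

variable {D : Type*} {S : CarpetSystem D}

/-! ### Pinched partitions -/

/-- The cells in `A` and the cells outside `A` meet in the point `(x, y)` only. -/
def Pinched (S : CarpetSystem D) (A : Set D) (x y : ℝ) : Prop :=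
  A.Nonempty ∧ Aᶜ.Nonempty ∧
    ∀ v ∈ A, ∀ w ∉ A, ∀ x' y', S.Cell v x' y' → S.Cell w x' y' → x' = x ∧ y' = y

/-- The cells `v` and `w` have a common point. -/
def Meets (S : CarpetSystem D) (v w : D) : Prop := ∃ x y, S.Cell v x y ∧ S.Cell w x y

theorem Pinched.swap {A : Set D} {x y : ℝ} (h : S.Pinched A x y) : S.swap.Pinched A y x :=
  ⟨h.1, h.2.1, fun v hv w hw x' y' h1 h2 =>
    (h.2.2 v hv w hw y' x' (S.swap_cell.1 h1) (S.swap_cell.1 h2)).symm⟩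

theorem Pinched.compl {A : Set D} {x y : ℝ} (h : S.Pinched A x y) : S.Pinched Aᶜ x y :=
  ⟨h.2.1, by rw [compl_compl]; exact h.1, fun v hv w hw x' y' h1 h2 =>
    h.2.2 w (by simpa using hw) v hv x' y' h2 h1⟩

theorem Meets.symm {v w : D} (h : S.Meets v w) : S.Meets w v := by
  obtain ⟨x, y, h1, h2⟩ := h
  exact ⟨x, y, h2, h1⟩

theorem Pinched.exists_cells {A : Set D} {x y : ℝ} (h : S.Pinched A x y) :
    ∃ v ∈ A, ∃ w ∉ A, S.Cell v x y ∧ S.Cell w x y := by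
  obtain ⟨v, hv, w, hw, p, q, p', q', hK, hK', hp, hq⟩ := S.conn A h.1 h.2.1
  have c1 : S.Cell v (S.X.g v p) (S.Y.g v q) := ⟨p, q, hK, rfl, rfl⟩
  have c2 : S.Cell w (S.X.g v p) (S.Y.g v q) := ⟨p', q', hK', hp.symm, hq.symm⟩
  obtain ⟨h1, h2⟩ := h.2.2 v hv w hw _ _ c1 c2
  rw [h1, h2] at c1 c2
  exact ⟨v, hv, w, hw, c1, c2⟩

/-- Every facing height is a common point of the row neighbours `v` and `w`, and these have only the
pinch point in common. -/
theorem Pinched.facing_unique {A : Set D} {x y : ℝ} (h : S.Pinched A x y) {v w : D} (hv : v ∈ A)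
    (hw : w ∉ A) {σ : Bool} (hvw : S.RowNext σ v w) {t t' : ℝ} (ht : S.Facing t)
    (ht' : S.Facing t') : t = t' := by
  have key : ∀ {t}, S.Facing t → S.Y.g v t = y := fun {t} ht =>
    (h.2.2 v hv w hw (S.X.g v (side σ)) (S.Y.g v t) ⟨_, _, ht σ, rfl, rfl⟩
      ⟨_, _, ht (!σ), (S.X.glue hvw.1).symm, by rw [S.Y.g_congr hvw.2]⟩).2
  exact S.Y.g_injective v ((key ht).trans (key ht').symm)

/-- Four cells around a grid vertex form two row pairs. The pair `a`, `b` shows that one of the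
heights 0, 1 is facing and the pair `c`, `d` that the other is, so `a` and `b` would meet twice
across the partition. -/
theorem Pinched.not_four_of_rowNext {A : Set D} {x y : ℝ} (h : S.Pinched A x y) {a b c d : D}
    (ha : a ∈ A) (hb : b ∉ A) {σ : Bool} (hab : S.RowNext σ a b) (ca : S.Cell a x y)
    (cb : S.Cell b x y) (cc : S.Cell c x y) (cd : S.Cell d x y) (hca : c ≠ a) (hcb : c ≠ b)
    (hda : d ≠ a) (hdb : d ≠ b) (hcd : c ≠ d) : False := by
  obtain ⟨p, q, hK, rfl, rfl⟩ := ca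
  have hrow : ∀ {w p' q'}, w ≠ a → S.K p' q' → S.X.g w p' = S.X.g a p →
      S.Y.g w q' = S.Y.g a q → w ≠ b → p = side σ → ∃ τ, q = side τ ∧ q' = side (!τ) ∧
        IsNext τ (S.Y.idx a) (S.Y.idx w) ∧
        ((S.X.idx w = S.X.idx a ∧ p' = side σ) ∨ (S.X.idx w = S.X.idx b ∧ p' = side !σ)) := by
    intro w p' q' hwa hK' hp hq hwb hpσ
    rcases meet_cases hwa.symm hK hK' hp.symm hq.symm with
      ⟨σ', h1, h2, h3, h4⟩ | ⟨τ, h1, h2, h3, h4⟩ | ⟨σ', τ, h1, h2, h3, h4, h5⟩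
    · obtain rfl := side_injective (hpσ.symm.trans h2)
      exact absurd (S.inj (h1.1.right_unique hab.1) (h1.2.symm.trans hab.2)) hwb
    · exact ⟨τ, h2, h3, h1.1, Or.inl ⟨h1.2.symm, h4.symm.trans hpσ⟩⟩
    · obtain rfl := side_injective (hpσ.symm.trans h2)
      exact ⟨τ, h4, h5, h1.2, Or.inr ⟨h1.1.right_unique hab.1, h3⟩⟩
  obtain ⟨pb, qb, hKb, hpb, hqb⟩ := cb
  obtain ⟨pc, qc, hKc, hpc, hqc⟩ := cc
  obtain ⟨pd, qd, hKd, hpd, hqd⟩ := cd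
  have hσ : p = side σ ∧ S.Facing q := by
    rcases meet_cases hab.ne hK hKb hpb.symm hqb.symm with
      ⟨σ', h1, rfl, rfl, rfl⟩ | ⟨τ, h1, -⟩ | ⟨σ', τ, h1, -⟩
    · exact ⟨congrArg side (h1.1.side_unique hab.1), facing_of hK hKb⟩
    · exact absurd h1.2 hab.1.ne
    · exact absurd hab.2 h1.2.ne
  obtain ⟨τ, h1, rfl, h3, h4⟩ := hrow hca hKc hpc hqc hcb hσ.1
  obtain ⟨τ', h1', rfl, h3', h4'⟩ := hrow hda hKd hpd hqd hdb hσ.1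
  obtain rfl := side_injective (h1.symm.trans h1')
  have hY := h3.right_unique h3'
  have f : S.Facing (side !τ) := by
    rcases h4 with ⟨h4, rfl⟩ | ⟨h4, rfl⟩ <;> rcases h4' with ⟨h4', rfl⟩ | ⟨h4', rfl⟩
    · exact absurd (S.inj (h4.trans h4'.symm) hY) hcd
    · exact facing_of hKc hKd
    · exact facing_of hKd hKc
    · exact absurd (S.inj (h4.trans h4'.symm) hY) hcd
  have := side_injective (h1.symm.trans (h.facing_unique ha hb hab hσ.2 f))
  cases τ <;> simp at this

/-- At the pinch point one of the two sides has only one cell. -/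
theorem Pinched.exists_unique_cell {A : Set D} {x y : ℝ} (h : S.Pinched A x y) :
    (∃ v ∈ A, S.Cell v x y ∧ ∀ w ∈ A, S.Cell w x y → w = v) ∨
    (∃ v ∉ A, S.Cell v x y ∧ ∀ w ∉ A, S.Cell w x y → w = v) := by
  obtain ⟨a, ha, b, hb, ca, cb⟩ := h.exists_cells
  by_contra! hcon
  obtain ⟨a', ha', ca', haa⟩ := hcon.1 a ha ca
  obtain ⟨b', hb', cb', hbb⟩ := hcon.2 b hb cb
  have hne : ∀ {u w : D}, u ∈ A → w ∉ A → u ≠ w := fun {_ _} hu hw e => hw (e ▸ hu)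
  -- With two cells on each side at the point, no pair across the partition is a row or column pair.
  -- So `b` and `b'` are both diagonal to `a` at the same corner, hence equal.
  have four : ∀ {b b'}, b ∉ A → b' ∉ A → S.Cell b x y → S.Cell b' x y → b' ≠ b →
      (∃ σ, S.RowNext σ a b) ∨ (∃ σ, S.swap.RowNext σ a b) → False := by
    rintro b b' hb hb' cb cb' hbb (⟨σ, hr⟩ | ⟨σ, hr⟩)
    · exact h.not_four_of_rowNext ha hb hr ca cb ca' cb' haa (hne ha' hb) (hne ha hb').symm hbb
        (hne ha' hb')
    · exact h.swap.not_four_of_rowNext ha hb hr (S.swap_cell.2 ca) (S.swap_cell.2 cb)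
        (S.swap_cell.2 ca') (S.swap_cell.2 cb') haa (hne ha' hb) (hne ha hb').symm hbb
        (hne ha' hb')
  have diag : ∀ {b b'}, b ∉ A → b' ∉ A → S.Cell b x y → S.Cell b' x y → b' ≠ b →
      ∃ σ τ, S.DiagNext σ τ a b ∧ x = S.X.g a (side σ) ∧ y = S.Y.g a (side τ) := by
    intro b b' hb hb' cb cb' hbb
    obtain ⟨p, q, hK, hp, hq⟩ := ca
    obtain ⟨p', q', hK', hp', hq'⟩ := id cb
    rcases meet_cases (hne ha hb) hK hK' (hp.trans hp'.symm) (hq.trans hq'.symm) with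
      ⟨σ, h1, -⟩ | ⟨τ, h1, -⟩ | ⟨σ, τ, h1, rfl, -, rfl, -⟩
    · exact (four hb hb' cb cb' hbb (Or.inl ⟨σ, h1⟩)).elim
    · exact (four hb hb' cb cb' hbb (Or.inr ⟨τ, h1⟩)).elim
    · exact ⟨σ, τ, h1, hp.symm, hq.symm⟩
  obtain ⟨σ, τ, h1, e1, e2⟩ := diag hb hb' cb cb' hbb
  obtain ⟨σ', τ', h1', e1', e2'⟩ := diag hb' hb cb' cb hbb.symm
  obtain rfl := side_injective (S.X.g_injective a (e1.symm.trans e1'))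
  obtain rfl := side_injective (S.Y.g_injective a (e2.symm.trans e2'))
  exact hbb (S.inj (h1'.1.right_unique h1.1) (h1'.2.right_unique h1.2))

/-! ### Tame points: pinch points with a unique address -/

/-- Corners, and the points of a facing pair if there is only one such pair. -/
def Tame (S : CarpetSystem D) (p q : ℝ) : Prop :=
  S.K p q ∧ ((∃ σ τ, p = side σ ∧ q = side τ) ∨
    (∃ σ, p = side σ ∧ S.Facing q ∧ ∀ t, S.Facing t → t = q) ∨
    (∃ τ, q = side τ ∧ S.swap.Facing p ∧ ∀ t, S.swap.Facing t → t = p))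

theorem Tame.swap {p q : ℝ} (h : S.Tame p q) : S.swap.Tame q p := by
  refine ⟨h.1, ?_⟩
  rcases h.2 with ⟨σ, τ, h1, h2⟩ | h1 | h1
  · exact Or.inl ⟨τ, σ, h2, h1⟩
  · exact Or.inr (Or.inr h1)
  · exact Or.inr (Or.inl h1)

theorem Pinched.tame {A : Set D} {x y : ℝ} (h : S.Pinched A x y) {v : D} (hv : v ∈ A) {p q : ℝ}
    (hK : S.K p q) (hp : S.X.g v p = x) (hq : S.Y.g v q = y) : S.Tame p q := by
  obtain ⟨-, -, w, hw, -, p', q', hK', hp', hq'⟩ := h.exists_cells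
  refine ⟨hK, ?_⟩
  rcases meet_cases (v := v) (w := w) (fun e => hw (e ▸ hv)) hK hK' (hp.trans hp'.symm)
    (hq.trans hq'.symm) with
    ⟨σ, h1, rfl, rfl, rfl⟩ | ⟨τ, h1, rfl, rfl, rfl⟩ | ⟨σ, τ, h1, rfl, -, rfl, -⟩
  · exact Or.inr (Or.inl ⟨σ, rfl, facing_of hK hK', fun t ht =>
      h.facing_unique hv hw h1 ht (facing_of hK hK')⟩)
  · exact Or.inr (Or.inr ⟨τ, rfl, facing_of (S := S.swap) hK hK', fun t ht =>
      h.swap.facing_unique hv hw h1 ht (facing_of (S := S.swap) hK hK')⟩)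
  · exact Or.inl ⟨σ, τ, rfl, rfl⟩

theorem eq_of_cell_corner {σ τ : Bool} {v w : D} (hv : S.Cell v (side σ) (side τ))
    (hw : S.Cell w (side σ) (side τ)) : v = w :=
  S.inj (hv.idx_left.1.trans hw.idx_left.1.symm) (hv.idx_right.1.trans hw.idx_right.1.symm)

/-- If the two cells of the facing pair share a row, their common fixed height is facing and equals
`q` by uniqueness, so the position repeats. Otherwise `q` is a grid height and the position is a
corner. Two cells on one side would make `q` an inner grid height; the opposite cell shares a row
with one of them, and then `q` would be the fixed height of that row, hence an endpoint. -/
theorem tame_step_of_facing {σ : Bool} {q : ℝ} (hq : S.Facing q)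
    (hun : ∀ t, S.Facing t → t = q) :
    ∃ w p' q', S.Tame p' q' ∧ S.X.g w p' = side σ ∧ S.Y.g w q' = q ∧
      ∀ w', S.Cell w' (side σ) q → w' = w := by
  obtain ⟨w, hw⟩ := S.exists_cell (hq σ)
  obtain ⟨hwi, s, hs, hst⟩ := hw.idx_left
  obtain ⟨c, hc⟩ := S.exists_cell (hq !σ)
  obtain ⟨hci, s', hs', hst'⟩ := hc.idx_left
  have hfix : ∀ {v}, S.X.idx v = S.X.ext σ → S.Y.idx v = S.Y.idx c → S.Y.g v q = q := by
    intro v hv hvc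
    obtain ⟨u, hu, hvu⟩ := exists_facing_fixed hv hci hvc
    rwa [hun u hu] at hvu
  refine ⟨w, side σ, s, ⟨hs, ?_⟩, S.X.g_ext hwi, hst, ?_⟩
  · rcases S.Y.meet (S.mem_right hs) (S.mem_right hs') (hst.trans hst'.symm) with
      ⟨h1, -⟩ | ⟨ρ, -, rfl, -⟩
    · obtain rfl := S.Y.g_injective w (hst.trans (hfix hwi h1).symm)
      exact Or.inr (Or.inl ⟨σ, rfl, hq, hun⟩)
    · exact Or.inl ⟨σ, ρ, rfl, rfl⟩
  · intro w' hw'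
    obtain ⟨hwi', s'', hs'', hst''⟩ := hw'.idx_left
    rcases S.Y.meet (S.mem_right hs) (S.mem_right hs'') (hst.trans hst''.symm) with
      ⟨h1, -⟩ | ⟨τ, h1, rfl, rfl⟩
    · exact S.inj (hwi'.trans hwi.symm) h1.symm
    · exfalso
      have hq1 : ∀ ρ, q ≠ side ρ := fun ρ => hst ▸ S.Y.g_ne_side h1
      rcases S.Y.meet (S.mem_right hs) (S.mem_right hs') (hst.trans hst'.symm) with
        ⟨h2, -⟩ | ⟨ρ, h2, h3, -⟩
      · exact hq1 _ (S.Y.g_injective w ((hfix hwi h2).trans hst.symm))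
      · obtain rfl := side_injective h3
        exact hq1 _ (S.Y.g_injective w'
          ((hfix hwi' (h1.right_unique h2)).trans hst''.symm))

/-- A tame point lies in one cell only, and its position in this cell is again tame. -/
theorem Tame.step {p q : ℝ} (h : S.Tame p q) : ∃ w p' q', S.Tame p' q' ∧ S.X.g w p' = p ∧
    S.Y.g w q' = q ∧ ∀ w', S.Cell w' p q → w' = w := by
  rcases h.2 with ⟨σ, τ, rfl, rfl⟩ | ⟨σ, rfl, h1, h2⟩ | ⟨τ, rfl, h1, h2⟩
  · obtain ⟨w, hw⟩ := S.exists_cell h.1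
    exact ⟨w, _, _, h, S.X.g_ext hw.idx_left.1, S.Y.g_ext hw.idx_right.1,
      fun w' hw' => eq_of_cell_corner hw' hw⟩
  · exact tame_step_of_facing h1 h2
  · obtain ⟨w, p', q', h3, h4, h5, h6⟩ := tame_step_of_facing (S := S.swap) (σ := τ) h1 h2
    exact ⟨w, q', p', h3.swap, h5, h4, fun w' hw' => h6 w' (S.swap_cell.2 hw')⟩

/-! ### Tails -/

/-- The cells other than `e` cannot be split into two sets of cells that do not meet. -/
def ConnectedOff (S : CarpetSystem D) (e : D) : Prop :=
  ∀ B : Set D, (∃ v ∈ B, v ≠ e) → (∃ w ∉ B, w ≠ e) → ∃ v ∈ B, ∃ w ∉ B, v ≠ e ∧ w ≠ e ∧ S.Meets v w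

/-- All contact points of `v` have the address `e e e ⋯`, and the subdivisions of the carpet stay
connected if the cell with this address is removed. -/
def IsTail (S : CarpetSystem D) (v e : D) : Prop :=
  (∃ T : ℝ → ℝ → Prop, (∀ p q, S.Contact v p q → T p q) ∧
    ∀ w p q, S.K p q → T (S.X.g w p) (S.Y.g w q) → w = e ∧ T p q) ∧
  (∀ p q, S.Contact e p q → ¬ S.Cell e p q) ∧ S.ConnectedOff e

/-- `A` has the pinch point `(x, y)`, which lies in only one cell `v` of `A`. -/
def PinchedAt (S : CarpetSystem D) (A : Set D) (x y : ℝ) (v : D) : Prop :=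
  S.Pinched A x y ∧ v ∈ A ∧ S.Cell v x y ∧ ∀ w ∈ A, S.Cell w x y → w = v

theorem ConnectedOff.swap {e : D} (h : S.ConnectedOff e) : S.swap.ConnectedOff e := by
  intro B h1 h2
  obtain ⟨v, hv, w, hw, hve, hwe, x, y, c1, c2⟩ := h B h1 h2
  exact ⟨v, hv, w, hw, hve, hwe, y, x, S.swap_cell.2 c1, S.swap_cell.2 c2⟩

theorem PinchedAt.swap {A : Set D} {x y : ℝ} {v : D} (h : S.PinchedAt A x y v) :
    S.swap.PinchedAt A y x v :=
  ⟨h.1.swap, h.2.1, S.swap_cell.2 h.2.2.1, fun w hw hc => h.2.2.2 w hw (S.swap_cell.1 hc)⟩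

/-- A corner cell has neighbours only on its inner sides, whereas its own copy of `e` touches only
the outer sides. -/
theorem not_cell_of_contact_corner {e : D} {σ τ : Bool} (h : S.X.idx e = S.X.ext σ)
    (h' : S.Y.idx e = S.Y.ext τ) {p q : ℝ} (hc : S.Contact e p q) : ¬ S.Cell e p q := by
  intro hcell
  rcases hc.cases with ⟨ρ, w, h1, rfl, -⟩ | ⟨ρ, w, h1, rfl, -⟩ | ⟨ρ, τ, w, h1, rfl, rfl⟩
  · obtain rfl := S.X.side_of_isNext_ext h h1.1
    have := S.X.ext_injective (h.symm.trans hcell.idx_left.1)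
    cases σ <;> simp at this
  · obtain rfl := S.Y.side_of_isNext_ext h' h1.1
    have := S.Y.ext_injective (h'.symm.trans hcell.idx_right.1)
    cases τ <;> simp at this
  · obtain rfl := S.X.side_of_isNext_ext h h1.1
    have := S.X.ext_injective (h.symm.trans hcell.idx_left.1)
    cases σ <;> simp at this

/-- A cell in an end column has at most one row neighbour, and with a single facing height the two
meet in one point. Hence `B` touches the rest in that point alone, through one cell on each side. -/
theorem pinchedAt_of_rowNext_only {e : D} {σ τ : Bool} (he : S.X.idx e = S.X.ext σ)
    (hun : ∀ t, S.Facing t → t = side τ) {B : Set D} (heB : e ∉ B)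
    (hB : B.Nonempty) (hno : ∀ v ∈ B, ∀ w ∉ B, w ≠ e → ¬ S.Meets v w)
    (hrow : ∀ v ∈ B, S.Meets v e → ∃ ρ, S.RowNext ρ e v) :
    ∃ x y v, S.PinchedAt B x y v ∧ S.PinchedAt Bᶜ x y e := by
  have hP : S.Pinched B (S.X.g e (side !σ)) (S.Y.g e (side τ)) := by
    refine ⟨hB, ⟨e, heB⟩, fun v hv w hw x' y' c1 c2 => ?_⟩
    obtain rfl : w = e := by
      by_contra hwe
      exact hno v hv w hw hwe ⟨x', y', c1, c2⟩
    obtain ⟨ρ, hr⟩ := hrow v hv ⟨x', y', c1, c2⟩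
    obtain rfl := S.X.side_of_isNext_ext he hr.1
    obtain ⟨p, q, hK, rfl, rfl⟩ := c2
    obtain ⟨p', q', hK', hp', hq'⟩ := c1
    rcases meet_cases hr.ne hK hK' hp'.symm hq'.symm with
      ⟨σ', h1, rfl, rfl, rfl⟩ | ⟨τ, h1, -⟩ | ⟨σ', τ, h1, -⟩
    · rw [hun _ (facing_of hK hK'), h1.1.side_unique hr.1]
      exact ⟨rfl, rfl⟩
    · exact absurd h1.2 hr.1.ne
    · exact absurd hr.2 h1.2.ne
  obtain ⟨v, hv, w, hw, c1, c2⟩ := hP.exists_cells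
  obtain rfl : w = e := by
    by_contra hwe
    exact hno v hv w hw hwe ⟨_, _, c1, c2⟩
  refine ⟨_, _, v, ⟨hP, hv, c1, fun v' hv' c1' => ?_⟩, hP.compl, hw, c2, fun w' hw' c2' => ?_⟩
  · obtain ⟨ρ, hr⟩ := hrow v hv ⟨_, _, c1, c2⟩
    obtain ⟨ρ', hr'⟩ := hrow v' hv' ⟨_, _, c1', c2⟩
    obtain rfl := S.X.side_of_isNext_ext he hr.1
    obtain rfl := S.X.side_of_isNext_ext he hr'.1
    exact S.inj (hr'.1.right_unique hr.1) (hr'.2.symm.trans hr.2)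
  · by_contra hwe
    exact hno v hv w' hw' hwe ⟨_, _, c1, c2'⟩

/-- If the only facing pair lies on the side `τ`, then the carpet minus a corner cell on this side
is connected or the carpet has a pinch point which lies in two cells only. -/
theorem connectedOff_or_pinchedAt {e : D} {σ τ : Bool} (he : S.X.idx e = S.X.ext σ)
    (he' : S.Y.idx e = S.Y.ext τ) (hf : S.Facing (side τ))
    (hun : ∀ t, S.Facing t → t = side τ) :
    S.ConnectedOff e ∨ ∃ A x y v w, S.PinchedAt A x y v ∧ S.PinchedAt Aᶜ x y w := by
  rw [or_iff_not_imp_left]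
  intro hcon
  unfold ConnectedOff at hcon
  push Not at hcon
  obtain ⟨B, ⟨v₀, hv₀, hve₀⟩, ⟨w₀, hw₀, hwe₀⟩, hno⟩ := hcon
  -- The neighbours of `e` outside its row are at most two, one above the other column position:
  -- they are row neighbours of each other and meet because a facing height exists. So they lie in
  -- the same part, and the other part reaches `e` only along its row.
  have trans : ∀ {v}, v ≠ e → S.Meets v e → (∃ ρ, S.RowNext ρ e v) ∨
      IsNext (!τ) (S.Y.idx e) (S.Y.idx v) ∧
        (S.X.idx v = S.X.idx e ∨ IsNext (!σ) (S.X.idx e) (S.X.idx v)) := by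
    rintro v hve ⟨x, y, ⟨p', q', hK', hp', hq'⟩, p, q, hK, hp, hq⟩
    rcases meet_cases hve.symm hK hK' (hp.trans hp'.symm) (hq.trans hq'.symm) with
      ⟨ρ, h1, -⟩ | ⟨ρ, h1, -⟩ | ⟨ρ, ρ', h1, -⟩
    · exact Or.inl ⟨ρ, h1⟩
    · obtain rfl := S.Y.side_of_isNext_ext he' h1.1
      exact Or.inr ⟨h1.1, Or.inl h1.2.symm⟩
    · obtain rfl := S.X.side_of_isNext_ext he h1.1
      obtain rfl := S.Y.side_of_isNext_ext he' h1.2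
      exact Or.inr ⟨h1.2, Or.inr h1.1⟩
  by_cases hB : ∀ v ∈ B, v ≠ e → S.Meets v e → ∃ ρ, S.RowNext ρ e v
  · obtain ⟨x, y, v, h1, h2⟩ := pinchedAt_of_rowNext_only he hun (B := B \ {e}) (by simp)
      ⟨v₀, hv₀, hve₀⟩ (fun v hv w hw hwe => hno v hv.1 w (fun h => hw ⟨h, hwe⟩) hv.2 hwe)
      (fun v hv hm => hB v hv.1 hv.2 hm)
    exact ⟨_, x, y, v, e, h1, h2⟩
  · push Not at hB
    obtain ⟨v, hv, hve, hm, hnr⟩ := hB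
    obtain ⟨hvY, hvX⟩ := (trans hve hm).resolve_left (by push Not; exact hnr)
    obtain ⟨x, y, w, h1, h2⟩ := pinchedAt_of_rowNext_only he hun (B := Bᶜ \ {e}) (by simp)
      ⟨w₀, hw₀, hwe₀⟩
      (fun v hv w hw hwe hm => hno w (by by_contra h; exact hw ⟨h, hwe⟩) v hv.1 hwe hv.2 hm.symm)
      (fun w hw hmw => by
        refine (trans hw.2 hmw).resolve_right ?_
        rintro ⟨hwY, hwX⟩
        have hY := hvY.right_unique hwY
        have meets : ∀ {ρ a b}, S.RowNext ρ a b → S.Meets a b := fun {ρ a b} hr =>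
          ⟨S.X.g a (side ρ), S.Y.g a (side τ), ⟨_, _, hf ρ, rfl, rfl⟩,
            ⟨_, _, hf (!ρ), (S.X.glue hr.1).symm, by rw [S.Y.g_congr hr.2]⟩⟩
        have hvw : v ≠ w := fun e => hw.1 (e ▸ hv)
        rcases hvX with hvX | hvX <;> rcases hwX with hwX | hwX
        · exact hvw (S.inj (hvX.trans hwX.symm) hY)
        · exact hno v hv w hw.1 hve hw.2 (meets (ρ := !σ) ⟨hvX ▸ hwX, hY⟩)
        · exact hno v hv w hw.1 hve hw.2
            (Meets.symm (meets (ρ := !σ) ⟨hwX ▸ hvX, hY.symm⟩))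
        · exact hvw (S.inj (hvX.right_unique hwX) hY))
    exact ⟨_, x, y, w, e, h1, h2⟩

theorem corner_tail {v e : D} {σ τ : Bool} (he : S.X.idx e = S.X.ext σ)
    (he' : S.Y.idx e = S.Y.ext τ) (hv : ∀ p q, S.Contact v p q → p = side σ ∧ q = side τ)
    (hco : S.ConnectedOff e) : S.IsTail v e := by
  refine ⟨⟨fun p q => p = side σ ∧ q = side τ, hv, ?_⟩,
    fun p q => not_cell_of_contact_corner he he', hco⟩
  rintro w p q hK ⟨h1, h2⟩
  obtain ⟨h3, h4⟩ := S.X.eq_side_of_g (S.mem_left hK) h1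
  obtain ⟨h5, h6⟩ := S.Y.eq_side_of_g (S.mem_right hK) h2
  exact ⟨S.inj (h3.trans he.symm) (h5.trans he'.symm), h4, h6⟩

/-- A pinch point in at least three cells, one of which is on one side of the partition. -/
theorem Pinched.tail_or_pinchedAt {v b c : D} {x y : ℝ} (h : S.Pinched {v} x y) (hb : b ≠ v)
    (hc : c ≠ v) (hbc : b ≠ c) (cb : S.Cell b x y) (cc : S.Cell c x y) :
    (∃ e, S.IsTail v e) ∨ ∃ A x y v w, S.PinchedAt A x y v ∧ S.PinchedAt Aᶜ x y w := by
  obtain ⟨a, rfl, -, -, ⟨p, q, hK, hp, hq⟩, -⟩ := h.exists_cells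
  have hcontact : ∀ p' q', S.Contact a p' q' → p' = p ∧ q' = q := by
    rintro p' q' ⟨hK', w, hw, hcw⟩
    obtain ⟨h1, h2⟩ := h.2.2 a rfl w hw _ _ ⟨p', q', hK', rfl, rfl⟩ hcw
    exact ⟨S.X.g_injective a (h1.trans hp.symm), S.Y.g_injective a (h2.trans hq.symm)⟩
  -- Stated for an arbitrary system so that it applies to `S.swap` too. The pinch point is a corner
  -- of `a`, and the cell `e` at this corner is the candidate for the tail.
  have core : ∀ {S : CarpetSystem D} {w : D} {p q x y : ℝ} {σ τ : Bool}, S.Pinched {a} x y →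
      w ≠ a → S.K p q → (∀ p' q', S.Contact a p' q' → p' = p ∧ q' = q) → S.RowNext σ a w →
      S.Facing q → p = side σ → q = side τ →
      (∃ e, S.IsTail a e) ∨ ∃ A x y v w, S.PinchedAt A x y v ∧ S.PinchedAt Aᶜ x y w := by
    intro S w p q x y σ τ h hw hK hcontact hr hf hpσ hqτ
    subst hpσ hqτ
    obtain ⟨e, he⟩ := S.exists_cell hK
    rcases connectedOff_or_pinchedAt he.idx_left.1 he.idx_right.1 hf
      (fun t ht => h.facing_unique rfl hw hr ht hf) with h1 | h1
    · exact Or.inl ⟨e, corner_tail he.idx_left.1 he.idx_right.1 hcontact h1⟩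
    · exact Or.inr h1
  have coreX : ∀ {w σ τ}, w ≠ a → S.RowNext σ a w → S.Facing q → p = side σ → q = side τ →
      (∃ e, S.IsTail a e) ∨ ∃ A x y v w, S.PinchedAt A x y v ∧ S.PinchedAt Aᶜ x y w :=
    fun h1 h2 h3 h4 h5 => core h h1 hK hcontact h2 h3 h4 h5
  have coreY : ∀ {w σ τ}, w ≠ a → S.swap.RowNext τ a w → S.swap.Facing p → p = side σ →
      q = side τ →
      (∃ e, S.IsTail a e) ∨ ∃ A x y v w, S.PinchedAt A x y v ∧ S.PinchedAt Aᶜ x y w := by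
    intro w σ τ h1 h2 h3 h4 h5
    rcases core (S := S.swap) h.swap h1 hK
      (fun p' q' h => (hcontact q' p' (S.swap_contact.1 h)).symm) h2 h3 h5 h4 with
      ⟨e, ⟨T, hT, hT'⟩, h7, h8⟩ | ⟨A, x, y, v, w, h6, h7⟩
    · exact Or.inl ⟨e, ⟨fun p q => T q p, fun p q hc => hT q p (S.swap_contact.2 hc),
        fun w p q hK ht => hT' w q p hK ht⟩,
        fun p q hc hcell => h7 q p (S.swap_contact.2 hc) (S.swap_cell.2 hcell), h8.swap⟩
    · exact Or.inr ⟨A, y, x, v, w, h6.swap, h7.swap⟩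
  obtain ⟨pb, qb, hKb, hpb, hqb⟩ := cb
  obtain ⟨pc, qc, hKc, hpc, hqc⟩ := cc
  -- Neighbours of the same kind at one point would coincide. So one of `b`, `c` is a row or column
  -- neighbour, and the other puts the remaining coordinate on a side.
  rcases meet_cases hb.symm hK hKb (hp.trans hpb.symm) (hq.trans hqb.symm) with
    ⟨σ, h1, h2, rfl, rfl⟩ | ⟨τ, h1, h2, rfl, rfl⟩ | ⟨σ, τ, h1, h2, -, h4, -⟩ <;>
  rcases meet_cases hc.symm hK hKc (hp.trans hpc.symm) (hq.trans hqc.symm) with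
    ⟨σ', h1', h2', rfl, h3'⟩ | ⟨τ', h1', h2', rfl, h3'⟩ | ⟨σ', τ', h1', h2', -, h4', -⟩
  · obtain rfl := side_injective (h2.symm.trans h2')
    exact absurd (S.inj (h1.1.right_unique h1'.1) (h1.2.symm.trans h1'.2)) hbc
  · exact coreX hb h1 (facing_of (h2 ▸ hK) hKb) h2 h2'
  · exact coreX hb h1 (facing_of (h2 ▸ hK) hKb) h2 h4'
  · subst h3'
    exact coreX hc h1' (facing_of (h2' ▸ hK) hKc) h2' h2
  · obtain rfl := side_injective (h2.symm.trans h2')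
    exact absurd (S.inj (h1.2.symm.trans h1'.2) (h1.1.right_unique h1'.1)) hbc
  · exact coreY hb h1 (facing_of (S := S.swap) (h2 ▸ hK) hKb) h2' h2
  · subst h3'
    exact coreX hc h1' (facing_of (h2' ▸ hK) hKc) h2' h4
  · subst h3'
    exact coreY hc h1' (facing_of (S := S.swap) (h2' ▸ hK) hKc) h2 h2'
  · obtain rfl := side_injective (h2.symm.trans h2')
    obtain rfl := side_injective (h4.symm.trans h4')
    exact absurd (S.inj (h1.1.right_unique h1'.1) (h1.2.right_unique h1'.2)) hbc

/-- With only two cells, in adjacent columns, each is the only cell on its outer side. Contacts of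
`v` lie on side `σ`, where `w` is the only cell at every level; contacts of `w` lie on the other
side, which the subcell `w` does not reach. -/
theorem isTail_of_isNext {v w : D} (hall : ∀ u, u = v ∨ u = w) {σ : Bool}
    (hn : IsNext σ (S.X.idx v) (S.X.idx w)) {q q' : ℝ} (h : S.K (side σ) q)
    (h' : S.K (side !σ) q') : S.IsTail v w := by
  have hw : S.X.idx w = S.X.ext σ := by
    obtain ⟨u, hu⟩ := S.exists_cell h
    have hu := hu.idx_left.1
    rcases hall u with rfl | rfl
    · have := S.X.side_of_isNext_ext hu hn
      cases σ <;> simp at this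
    · exact hu
  have hv : S.X.idx v = S.X.ext (!σ) := by
    obtain ⟨u, hu⟩ := S.exists_cell h'
    have hu := hu.idx_left.1
    rcases hall u with rfl | rfl
    · exact hu
    · have := S.X.ext_injective (hw.symm.trans hu)
      cases σ <;> simp at this
  have hvw : v ≠ w := fun e => hn.ne (by rw [e])
  have contact : ∀ {a b : D} {ρ p q}, (∀ u, u ≠ a → u = b) →
      IsNext ρ (S.X.idx a) (S.X.idx b) → S.Contact a p q → p = side ρ := by
    intro a b ρ p q hab hρ hc
    rcases hc.cases with ⟨ρ', u, h1, rfl, -⟩ | ⟨ρ', u, h1, rfl, -⟩ | ⟨ρ', τ, u, h1, rfl, rfl⟩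
    · obtain rfl := hab u h1.ne.symm
      exact congrArg side (h1.1.side_unique hρ)
    · obtain rfl := hab u h1.ne.symm
      exact absurd h1.2 hρ.ne
    · obtain rfl := hab u (fun e => h1.1.ne (by rw [e]))
      exact congrArg side (h1.1.side_unique hρ)
  refine ⟨⟨fun p _ => p = side σ, fun p q hc =>
    contact (fun u hu => (hall u).resolve_left hu) hn hc, ?_⟩, ?_, ?_⟩
  · intro u p q hK hp
    obtain ⟨h1, h2⟩ := S.X.eq_side_of_g (S.mem_left hK) hp
    refine ⟨(hall u).resolve_left ?_, h2⟩
    rintro rfl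
    have := S.X.ext_injective (hv.symm.trans h1)
    cases σ <;> simp at this
  · intro p q hc hcell
    obtain rfl := contact (fun u hu => (hall u).resolve_right hu) hn.symm hc
    have := S.X.ext_injective (hw.symm.trans hcell.idx_left.1)
    cases σ <;> simp at this
  · rintro B ⟨a, ha, haw⟩ ⟨b, hb, hbw⟩
    rw [(hall a).resolve_right haw] at ha
    rw [(hall b).resolve_right hbw] at hb
    exact absurd ha hb

theorem IsTail.swap {v e : D} (h : S.IsTail v e) : S.swap.IsTail v e := by
  obtain ⟨⟨T, hT, hT'⟩, h7, h8⟩ := h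
  exact ⟨⟨fun p q => T q p, fun p q hc => hT q p (S.swap_contact.1 hc),
    fun w p q hK ht => hT' w q p hK ht⟩,
    fun p q hc hcell => h7 q p (S.swap_contact.1 hc) (S.swap_cell.1 hcell), h8.swap⟩

theorem exists_isTail_of_two {v w : D} (hvw : v ≠ w) (hall : ∀ u, u = v ∨ u = w) :
    S.IsTail v w := by
  obtain ⟨a, rfl, b, hb, p, q, p', q', hK, hK', hp, hq⟩ := S.conn {v} ⟨v, rfl⟩ ⟨w, hvw.symm⟩
  obtain rfl : b = w := (hall b).resolve_left hb
  rcases meet_cases hvw hK hK' hp hq with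
    ⟨σ, h1, rfl, rfl, rfl⟩ | ⟨τ, h1, rfl, rfl, rfl⟩ | ⟨σ, τ, h1, rfl, rfl, rfl, rfl⟩
  · exact isTail_of_isNext hall h1.1 hK hK'
  · exact (isTail_of_isNext (S := S.swap) hall h1.1 hK hK').swap
  · exact isTail_of_isNext hall h1.1 hK hK'

/-- A carpet with a pinched partition has a tail or a pinched partition one part of which has at
least two cells, only one of them at the pinch point. -/
theorem Pinched.exists_isTail_or {A : Set D} {x y : ℝ} (h : S.Pinched A x y) :
    (∃ v e, S.IsTail v e) ∨ ∃ A x y v, S.PinchedAt A x y v ∧ ∃ w ∈ A, w ≠ v := by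
  -- Whichever part has a second cell serves; if neither has, the carpet has exactly two cells.
  have both : ∀ {A x y v w}, S.PinchedAt A x y v → S.PinchedAt Aᶜ x y w →
      (∃ v e, S.IsTail v e) ∨ ∃ A x y v, S.PinchedAt A x y v ∧ ∃ w ∈ A, w ≠ v := by
    intro A x y v w h1 h2
    by_cases hv : ∃ u ∈ A, u ≠ v
    · exact Or.inr ⟨_, _, _, _, h1, hv⟩
    by_cases hw : ∃ u ∈ Aᶜ, u ≠ w
    · exact Or.inr ⟨_, _, _, _, h2, hw⟩
    push Not at hv hw
    refine Or.inl ⟨v, w, exists_isTail_of_two (fun e => h2.2.1 (e ▸ h1.2.1)) fun u => ?_⟩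
    by_cases hu : u ∈ A
    · exact Or.inl (hv u hu)
    · exact Or.inr (hw u hu)
  have main : ∀ {A : Set D} {v}, S.PinchedAt A x y v →
      (∃ v e, S.IsTail v e) ∨ ∃ A x y v, S.PinchedAt A x y v ∧ ∃ w ∈ A, w ≠ v := by
    intro A v h1
    by_cases hv : ∃ u ∈ A, u ≠ v
    · exact Or.inr ⟨_, _, _, _, h1, hv⟩
    push Not at hv
    obtain rfl : A = {v} := Set.eq_singleton_iff_unique_mem.2 ⟨h1.2.1, hv⟩
    obtain ⟨-, -, b, hb, -, cb⟩ := h1.1.exists_cells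
    by_cases hc : ∃ c, c ≠ v ∧ c ≠ b ∧ S.Cell c x y
    · obtain ⟨c, hcv, hcb, cc⟩ := hc
      rcases h1.1.tail_or_pinchedAt hb hcv hcb.symm cb cc with ⟨e, he⟩ | ⟨A, x, y, v, w, h2, h3⟩
      · exact Or.inl ⟨v, e, he⟩
      · exact both h2 h3
    · push Not at hc
      exact both h1 ⟨h1.1.compl, hb, cb, fun w hw cw => by
        by_contra hwb
        exact hc w hw hwb cw⟩
  rcases h.exists_unique_cell with ⟨v, hv, h1, h2⟩ | ⟨v, hv, h1, h2⟩
  · exact main ⟨h, hv, h1, h2⟩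
  · exact main (A := Aᶜ) ⟨h.compl, hv, h1, h2⟩

end CarpetSystem

namespace BaranskiData

/-! ### The grid of a probability vector -/

/-- The grid points `∑_{l < n} p_l`. -/
noncomputable def gridSum {N : ℕ} (p : Fin N → ℝ) (n : ℕ) : ℝ :=
  ∑ l : Fin N, if l.val < n then p l else 0

theorem offset_eq_gridSum {N : ℕ} (p : Fin N → ℝ) (j : Fin N) : offset p j = gridSum p j := by
  rw [offset, gridSum, ← Finset.sum_filter]
  congr 1
  ext l
  simp

theorem gridSum_zero {N : ℕ} (p : Fin N → ℝ) : gridSum p 0 = 0 := by simp [gridSum]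

theorem gridSum_self {N : ℕ} (p : Fin N → ℝ) : gridSum p N = ∑ j, p j := by simp [gridSum]

theorem gridSum_succ {N : ℕ} (p : Fin N → ℝ) (j : Fin N) :
    gridSum p (j + 1) = gridSum p j + p j := by
  have : p j = ∑ l : Fin N, if l = j then p l else 0 := by simp
  rw [gridSum, gridSum, this, ← Finset.sum_add_distrib]
  refine Finset.sum_congr rfl fun l _ => ?_
  rcases lt_trichotomy l j with h | rfl | h
  · have h' : l.val < j.val := h
    simp [h', h.ne, Nat.lt_succ_of_lt h']
  · simp
  · have h' : j.val < l.val := h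
    simp [h.ne', Nat.not_lt.2 h'.le, Nat.not_le.2 h']

theorem gridSum_lt {N : ℕ} {p : Fin N → ℝ} (hp : ∀ j, 0 < p j) {i j : ℕ} (hij : i < j)
    (hj : j ≤ N) : gridSum p i < gridSum p j := by
  induction j, hij using Nat.le_induction with
  | base => linarith [gridSum_succ p ⟨i, hj⟩, hp ⟨i, hj⟩]
  | succ j hij ih => linarith [gridSum_succ p ⟨j, hj⟩, hp ⟨j, hj⟩, ih (by omega)]

theorem gridSum_le {N : ℕ} {p : Fin N → ℝ} (hp : ∀ j, 0 < p j) {i j : ℕ} (hij : i ≤ j)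
    (hj : j ≤ N) : gridSum p i ≤ gridSum p j := by
  rcases hij.eq_or_lt with rfl | h
  · rfl
  · exact (gridSum_lt hp h hj).le

theorem affine_eq_of_lt {N : ℕ} {p : Fin N → ℝ} (hp : ∀ j, 0 < p j) {i j : Fin N} (hij : i < j)
    {s t : ℝ} (hs : s ≤ 1) (ht : 0 ≤ t) (h : p i * s + offset p i = p j * t + offset p j) :
    j.val = i.val + 1 ∧ s = 1 ∧ t = 0 := by
  rw [offset_eq_gridSum, offset_eq_gridSum] at h
  have h1 := gridSum_succ p i
  have h2 : gridSum p (i + 1) ≤ gridSum p j := gridSum_le hp hij j.2.le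
  have h3 : p i * s ≤ p i := by nlinarith [hp i]
  have h4 : 0 ≤ p j * t := mul_nonneg (hp j).le ht
  refine ⟨?_, ?_, ?_⟩
  · by_contra hne
    have : i.val < j.val := hij
    have := gridSum_lt hp (show i.val + 1 < j by omega) j.2.le
    linarith
  · have : p i * (s - 1) = 0 := by linarith
    rcases mul_eq_zero.1 this with h0 | h0
    · exact absurd h0 (hp i).ne'
    · linarith
  · have : p j * t = 0 := by linarith
    exact (mul_eq_zero.1 this).resolve_left (hp j).ne'

theorem offset_nonneg {N : ℕ} {p : Fin N → ℝ} (hp : ∀ j, 0 < p j) (j : Fin N) :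
    0 ≤ offset p j := Finset.sum_nonneg fun l _ => (hp l).le

theorem add_offset_le {N : ℕ} {p : Fin N → ℝ} (hp : ∀ j, 0 < p j) (hs : ∑ j, p j = 1)
    (j : Fin N) : p j + offset p j ≤ 1 := by
  rw [offset_eq_gridSum, ← hs, ← gridSum_self, add_comm, ← gridSum_succ]
  exact gridSum_le hp j.2 le_rfl

theorem affine_mem {N : ℕ} {p : Fin N → ℝ} (hp : ∀ j, 0 < p j) (hs : ∑ j, p j = 1)
    (j : Fin N) {s : ℝ} (h : s ∈ Set.Icc (0 : ℝ) 1) :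
    p j * s + offset p j ∈ Set.Icc (0 : ℝ) 1 := by
  have h1 := offset_nonneg hp j
  have h2 := add_offset_le hp hs j
  have h3 := hp j
  constructor <;> nlinarith [h.1, h.2, mul_nonneg h3.le h.1]

/-- The axis of a probability vector `p`. -/
noncomputable def axis {D : Type*} {N : ℕ} (hN : 2 ≤ N) (p : Fin N → ℝ) (hp : ∀ j, 0 < p j)
    (hs : ∑ j, p j = 1) (idx : D → Fin N) : GridAxis D where
  last := N - 1
  one_le_last := by omega
  idx w := idx w
  idx_le w := by have := (idx w).2; omega
  g w s := p (idx w) * s + offset p (idx w)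
  g_congr h := by rw [Fin.ext h]
  g_contract w := ⟨p (idx w), hp _, lt_one_of_sum hN p hp hs _, fun s t => by
    rw [show p (idx w) * s + offset p (idx w) - (p (idx w) * t + offset p (idx w)) =
      p (idx w) * (s - t) by ring, abs_mul, abs_of_pos (hp _)]⟩
  glue := by
    intro σ v w h
    have h1 := gridSum_succ p (idx v)
    have h2 := gridSum_succ p (idx w)
    cases σ
    · simp only [IsNext, Bool.false_eq_true, if_false] at h
      simp only [side, Bool.false_eq_true, if_false, Bool.not_false, if_true, offset_eq_gridSum]
      rw [h]
      linarith
    · simp only [IsNext, if_true] at h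
      simp only [side, Bool.false_eq_true, if_false, Bool.not_true, if_true, offset_eq_gridSum]
      rw [h]
      linarith
  meet := by
    intro v w s t hs ht h
    rcases lt_trichotomy (idx v) (idx w) with hlt | heq | hlt
    · obtain ⟨h1, h2, h3⟩ := affine_eq_of_lt hp hlt hs.2 ht.1 h
      exact Or.inr ⟨true, by simpa [IsNext] using h1, by simpa [side] using h2,
        by simpa [side] using h3⟩
    · rw [heq, add_left_inj] at h
      exact Or.inl ⟨congrArg _ heq, mul_left_cancel₀ (hp _).ne' h⟩
    · obtain ⟨h1, h2, h3⟩ := affine_eq_of_lt hp hlt ht.2 hs.1 h.symm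
      exact Or.inr ⟨false, by simpa [IsNext] using h1, by simpa [side] using h3,
        by simpa [side] using h2⟩
  g_end := by
    intro σ w h
    have h1 := gridSum_succ p (idx w)
    cases σ
    · simp only [Bool.false_eq_true, if_false] at h
      simp [side, offset_eq_gridSum, h, gridSum_zero]
    · simp only [if_true] at h
      have : (idx w).val + 1 = N := by omega
      rw [this, gridSum_self, hs] at h1
      simp only [side, if_true, mul_one, offset_eq_gridSum]
      linarith
  end_of := by
    intro σ w s hsI h
    have h0 := offset_nonneg hp (idx w)
    have h1 := add_offset_le hp hs (idx w)
    have h2 := hp (idx w)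
    rw [offset_eq_gridSum] at h0 h1 h
    cases σ
    · simp only [side, Bool.false_eq_true, if_false] at h ⊢
      have h3 := mul_nonneg h2.le hsI.1
      refine ⟨?_, ?_⟩
      · by_contra hne
        have := gridSum_lt hp (Nat.pos_of_ne_zero hne) (idx w).2.le
        rw [gridSum_zero] at this
        linarith
      · have : p (idx w) * s = 0 := by linarith
        exact (mul_eq_zero.1 this).resolve_left h2.ne'
    · simp only [side, if_true] at h ⊢
      have h3 : p (idx w) * s ≤ p (idx w) := by nlinarith [hsI.2]
      refine ⟨?_, ?_⟩
      · by_contra hne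
        have := gridSum_lt hp (show (idx w).val + 1 < N by have := (idx w).2; omega) le_rfl
        rw [gridSum_succ, gridSum_self, hs] at this
        linarith
      · have : p (idx w) * (s - 1) = 0 := by linarith
        rcases mul_eq_zero.1 this with h | h
        · exact absurd h h2.ne'
        · linarith

/-! ### Words and cylinders -/

variable (B : BaranskiData)

theorem exists_lipschitz : ∃ c : NNReal, c < 1 ∧ ∀ w, LipschitzWith c (B.psi w) := by
  have : Nonempty B.D := (Finset.card_pos.1 (by have := B.one_lt_card; omega)).to_subtype
  obtain ⟨w₀, hw₀⟩ := Finite.exists_max fun w : B.D => max (B.p₁ w.1.1) (B.p₂ w.1.2)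
  have h0 : 0 ≤ max (B.p₁ w₀.1.1) (B.p₂ w₀.1.2) := le_max_of_le_left (B.p₁_pos _).le
  obtain ⟨c, hc⟩ : ∃ c : NNReal, (c : ℝ) = max (B.p₁ w₀.1.1) (B.p₂ w₀.1.2) := ⟨⟨_, h0⟩, rfl⟩
  have hlt : (c : ℝ) < 1 := hc ▸ max_lt (lt_one_of_sum B.two_le_N₁ _ B.p₁_pos B.sum_p₁ _)
    (lt_one_of_sum B.two_le_N₂ _ B.p₂_pos B.sum_p₂ _)
  refine ⟨c, hlt, fun w => ?_⟩
  have h₁ : LipschitzWith c fun x : ℝ => B.p₁ w.1.1 * x + offset B.p₁ w.1.1 :=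
    lipschitzWith_affine (B.p₁_pos _) (hc ▸ (le_max_left _ _).trans (hw₀ w))
  have h₂ : LipschitzWith c fun x : ℝ => B.p₂ w.1.2 * x + offset B.p₂ w.1.2 :=
    lipschitzWith_affine (B.p₂_pos _) (hc ▸ (le_max_right _ _).trans (hw₀ w))
  have h := (h₁.comp LipschitzWith.prod_fst).prodMk (h₂.comp LipschitzWith.prod_snd)
  rw [mul_one, max_self] at h
  exact h

theorem psi_continuous (w : B.D) : Continuous (B.psi w) := by
  obtain ⟨c, -, h⟩ := B.exists_lipschitz
  exact (h w).continuous

theorem psi_injective (w : B.D) : Function.Injective (B.psi w) := by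
  rintro ⟨x, y⟩ ⟨x', y'⟩ h
  simp only [psi, Prod.mk.injEq, add_left_inj] at h
  exact Prod.ext (mul_left_cancel₀ (B.p₁_pos _).ne' h.1) (mul_left_cancel₀ (B.p₂_pos _).ne' h.2)

theorem mem_carpet_iff {x : ℝ × ℝ} : x ∈ B.carpet ↔ ∃ w, ∃ y ∈ B.carpet, B.psi w y = x := by
  conv_lhs => rw [B.isAttractor_carpet.2.2]
  simp

theorem isCompact_carpet : IsCompact B.carpet := B.isAttractor_carpet.1

theorem carpet_nonempty : B.carpet.Nonempty := B.isAttractor_carpet.2.1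

theorem psi_mem (w : B.D) {x : ℝ × ℝ} (h : x ∈ B.carpet) : B.psi w x ∈ B.carpet :=
  B.mem_carpet_iff.2 ⟨w, x, h, rfl⟩

theorem psiWord_cons {k : ℕ} (d : B.D) (u : Fin k → B.D) (x : ℝ × ℝ) :
    B.psiWord (k + 1) (Fin.cons d u) x = B.psi d (B.psiWord k u x) := by
  simp [psiWord]

theorem psiWord_succ {k : ℕ} (u : Fin (k + 1) → B.D) (x : ℝ × ℝ) :
    B.psiWord (k + 1) u x = B.psi (u 0) (B.psiWord k (Fin.tail u) x) := rfl

theorem psiWord_mem {k : ℕ} (u : Fin k → B.D) {x : ℝ × ℝ} (h : x ∈ B.carpet) :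
    B.psiWord k u x ∈ B.carpet := by
  induction k with
  | zero => exact h
  | succ k ih => exact B.psi_mem _ (ih _)

theorem psiWord_injective {k : ℕ} (u : Fin k → B.D) : Function.Injective (B.psiWord k u) := by
  induction k with
  | zero => exact Function.injective_id
  | succ k ih => exact (B.psi_injective _).comp (ih _)

theorem psiWord_continuous {k : ℕ} (u : Fin k → B.D) : Continuous (B.psiWord k u) := by
  induction k with
  | zero => exact continuous_id
  | succ k ih => exact (B.psi_continuous _).comp (ih _)

theorem psiWord_dist_le {c : NNReal} (hc : ∀ w, LipschitzWith c (B.psi w)) {k : ℕ}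
    (u : Fin k → B.D) (x y : ℝ × ℝ) :
    dist (B.psiWord k u x) (B.psiWord k u y) ≤ (c : ℝ) ^ k * dist x y := by
  induction k with
  | zero => simp [psiWord]
  | succ k ih =>
    rw [psiWord_succ, psiWord_succ, pow_succ', mul_assoc]
    exact ((hc _).dist_le_mul _ _).trans (mul_le_mul_of_nonneg_left (ih _) c.2)

/-- The cylinder `ψ_u(K)`. -/
def cyl {k : ℕ} (u : Fin k → B.D) : Set (ℝ × ℝ) := B.psiWord k u '' B.carpet

theorem cyl_subset {k : ℕ} (u : Fin k → B.D) : B.cyl u ⊆ B.carpet := by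
  rintro _ ⟨x, hx, rfl⟩
  exact B.psiWord_mem u hx

theorem isCompact_cyl {k : ℕ} (u : Fin k → B.D) : IsCompact (B.cyl u) :=
  B.isCompact_carpet.image (B.psiWord_continuous u)

theorem cyl_nonempty {k : ℕ} (u : Fin k → B.D) : (B.cyl u).Nonempty := B.carpet_nonempty.image _

theorem cyl_cons {k : ℕ} (d : B.D) (u : Fin k → B.D) :
    B.cyl (Fin.cons d u : Fin (k + 1) → B.D) = B.psi d '' B.cyl u := by
  rw [cyl, cyl, Set.image_image]
  exact Set.image_congr fun x _ => B.psiWord_cons d u x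

theorem cyl_succ {k : ℕ} (u : Fin (k + 1) → B.D) :
    B.cyl u = B.psi (u 0) '' B.cyl (Fin.tail u) := by
  rw [← cyl_cons, Fin.cons_self_tail]

theorem cyl_subset_psi {k : ℕ} (u : Fin (k + 1) → B.D) : B.cyl u ⊆ B.psi (u 0) '' B.carpet := by
  rw [cyl_succ]
  exact Set.image_mono (B.cyl_subset _)

theorem exists_mem_cyl (k : ℕ) {x : ℝ × ℝ} (hx : x ∈ B.carpet) :
    ∃ u : Fin k → B.D, x ∈ B.cyl u := by
  induction k generalizing x with
  | zero => exact ⟨Fin.elim0, x, hx, rfl⟩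
  | succ k ih =>
    obtain ⟨w, y, hy, rfl⟩ := B.mem_carpet_iff.1 hx
    obtain ⟨u, hu⟩ := ih hy
    exact ⟨Fin.cons w u, by rw [cyl_cons]; exact ⟨y, hu, rfl⟩⟩

theorem exists_cyl_small {ε : ℝ} (hε : 0 < ε) : ∃ m, ∀ k, m ≤ k → ∀ u : Fin k → B.D,
    ∀ x ∈ B.cyl u, ∀ y ∈ B.cyl u, dist x y < ε := by
  obtain ⟨c, hc, hL⟩ := B.exists_lipschitz
  obtain ⟨R, hR⟩ := Metric.isBounded_iff.1 B.isCompact_carpet.isBounded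
  have hR0 : 0 ≤ R := by
    obtain ⟨x, hx⟩ := B.carpet_nonempty
    simpa using hR hx hx
  obtain ⟨m, hm⟩ := exists_pow_lt_of_lt_one (show 0 < ε / (R + 1) by positivity)
    (show (c : ℝ) < 1 from hc)
  refine ⟨m, fun k hk u => ?_⟩
  rintro _ ⟨x, hx, rfl⟩ _ ⟨y, hy, rfl⟩
  have h1 : (c : ℝ) ^ k ≤ (c : ℝ) ^ m := pow_le_pow_of_le_one c.2 (le_of_lt hc) hk
  calc _ ≤ (c : ℝ) ^ k * dist x y := B.psiWord_dist_le hL u x y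
    _ ≤ (c : ℝ) ^ m * (R + 1) := by
        have := hR hx hy
        have h0 : (0 : ℝ) ≤ (c : ℝ) ^ m := pow_nonneg c.2 m
        exact mul_le_mul h1 (by linarith) dist_nonneg h0
    _ < ε := by
        rw [lt_div_iff₀ (by positivity)] at hm
        exact hm

theorem psi_mem_square (w : B.D) {x : ℝ × ℝ}
    (hx : x ∈ Set.Icc (0 : ℝ) 1 ×ˢ Set.Icc (0 : ℝ) 1) :
    B.psi w x ∈ Set.Icc (0 : ℝ) 1 ×ˢ Set.Icc (0 : ℝ) 1 :=
  ⟨affine_mem B.p₁_pos B.sum_p₁ _ hx.1, affine_mem B.p₂_pos B.sum_p₂ _ hx.2⟩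

/-- A point of `K` with a given address is approximated by the images of the origin under the
prefixes of the address, and these stay in the closed square. -/
theorem carpet_subset_square : B.carpet ⊆ Set.Icc (0 : ℝ) 1 ×ˢ Set.Icc (0 : ℝ) 1 := by
  obtain ⟨c, hc, hL⟩ := B.exists_lipschitz
  obtain ⟨R, hR⟩ := B.isCompact_carpet.isBounded.subset_closedBall (0 : ℝ × ℝ)
  have hsq : ∀ k, ∀ u : Fin k → B.D,
      B.psiWord k u 0 ∈ Set.Icc (0 : ℝ) 1 ×ˢ Set.Icc (0 : ℝ) 1 := by
    intro k
    induction k with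
    | zero => intro u; exact ⟨⟨le_rfl, zero_le_one⟩, ⟨le_rfl, zero_le_one⟩⟩
    | succ k ih => intro u; exact B.psi_mem_square _ (ih _)
  intro x hx
  rw [← (isClosed_Icc.prod isClosed_Icc).closure_eq, Metric.mem_closure_iff]
  intro ε hε
  have hR0 : 0 ≤ R := dist_nonneg.trans (hR hx)
  obtain ⟨m, hm⟩ := exists_pow_lt_of_lt_one (show 0 < ε / (R + 1) by positivity)
    (show (c : ℝ) < 1 from hc)
  obtain ⟨u, y, hy, rfl⟩ := B.exists_mem_cyl m hx
  refine ⟨_, hsq m u, (B.psiWord_dist_le hL u y 0).trans_lt ?_⟩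
  rw [lt_div_iff₀ (by positivity)] at hm
  have h1 : dist y 0 ≤ R := hR hy
  have h0 : (0 : ℝ) ≤ (c : ℝ) ^ m := pow_nonneg c.2 m
  nlinarith

/-- A finite union of images of `K` which is neither empty nor everything meets its complement. -/
theorem exists_meet_of_cover {ι : Type*} [Finite ι] (hconn : IsConnected B.carpet)
    (C : ι → Set (ℝ × ℝ)) (hC : ∀ i, IsClosed (C i)) (hne : ∀ i, (C i).Nonempty)
    (hsub : ∀ i, C i ⊆ B.carpet) (hcov : B.carpet ⊆ ⋃ i, C i) (A : Set ι) (hA : A.Nonempty)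
    (hA' : Aᶜ.Nonempty) : ∃ i ∈ A, ∃ j ∉ A, (C i ∩ C j).Nonempty := by
  have h := isPreconnected_closed_iff.1 hconn.isPreconnected (⋃ i ∈ A, C i) (⋃ i ∈ Aᶜ, C i)
    ((Set.toFinite A).isClosed_biUnion fun i _ => hC i)
    ((Set.toFinite Aᶜ).isClosed_biUnion fun i _ => hC i) ?_ ?_ ?_
  · obtain ⟨x, -, hx1, hx2⟩ := h
    simp only [Set.mem_iUnion] at hx1 hx2
    obtain ⟨i, hi, hxi⟩ := hx1
    obtain ⟨j, hj, hxj⟩ := hx2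
    exact ⟨i, hi, j, hj, x, hxi, hxj⟩
  · intro x hx
    obtain ⟨i, hi⟩ := Set.mem_iUnion.1 (hcov hx)
    by_cases hiA : i ∈ A
    · exact Or.inl (Set.mem_biUnion hiA hi)
    · exact Or.inr (Set.mem_biUnion (show i ∈ Aᶜ from hiA) hi)
  · obtain ⟨i, hi⟩ := hA
    obtain ⟨x, hx⟩ := hne i
    exact ⟨x, hsub i hx, Set.mem_biUnion hi hx⟩
  · obtain ⟨i, hi⟩ := hA'
    obtain ⟨x, hx⟩ := hne i
    exact ⟨x, hsub i hx, Set.mem_biUnion hi hx⟩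

theorem exists_fixed (w : B.D) : ∃ x ∈ B.carpet, B.psi w x = x := by
  obtain ⟨c, hc, hL⟩ := B.exists_lipschitz
  have hmaps : Set.MapsTo (B.psi w) B.carpet B.carpet := fun x hx => B.psi_mem w hx
  obtain ⟨x₀, hx₀⟩ := B.carpet_nonempty
  have hcw : ContractingWith c (hmaps.restrict (B.psi w) B.carpet B.carpet) :=
    ⟨hc, fun x y => hL w x y⟩
  obtain ⟨x, hx, hfx, -⟩ := hcw.exists_fixedPoint' B.isCompact_carpet.isComplete hmaps hx₀
    (edist_ne_top _ _)
  exact ⟨x, hx, hfx⟩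

theorem exists_meet_cells (hconn : IsConnected B.carpet) (A : Set B.D) (hA : A.Nonempty)
    (hA' : Aᶜ.Nonempty) :
    ∃ v ∈ A, ∃ w ∉ A, (B.psi v '' B.carpet ∩ B.psi w '' B.carpet).Nonempty :=
  B.exists_meet_of_cover hconn (fun w => B.psi w '' B.carpet)
    (fun w => (B.isCompact_carpet.image (B.psi_continuous w)).isClosed)
    (fun _ => B.carpet_nonempty.image _) (by rintro w _ ⟨x, hx, rfl⟩; exact B.psi_mem w hx)
    (fun x hx => by
      obtain ⟨w, y, hy, h⟩ := B.mem_carpet_iff.1 hx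
      exact Set.mem_iUnion.2 ⟨w, y, hy, h⟩) A hA hA'

/-- The carpet system of a connected carpet. -/
noncomputable def system (hconn : IsConnected B.carpet) : CarpetSystem B.D where
  X := axis B.two_le_N₁ B.p₁ B.p₁_pos B.sum_p₁ fun w => w.1.1
  Y := axis B.two_le_N₂ B.p₂ B.p₂_pos B.sum_p₂ fun w => w.1.2
  K x y := (x, y) ∈ B.carpet
  inj h h' := Subtype.ext (Prod.ext (Fin.ext h) (Fin.ext h'))
  mem_left h := (B.carpet_subset_square h).1
  mem_right h := (B.carpet_subset_square h).2
  K_iff := by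
    intro x y
    rw [B.mem_carpet_iff]
    constructor
    · rintro ⟨w, ⟨p, q⟩, h, e⟩
      exact ⟨w, p, q, h, congrArg Prod.fst e, congrArg Prod.snd e⟩
    · rintro ⟨w, p, q, h, e1, e2⟩
      exact ⟨w, (p, q), h, Prod.ext e1 e2⟩
  fixed w := by
    obtain ⟨⟨p, q⟩, h, e⟩ := B.exists_fixed w
    exact ⟨p, q, h, congrArg Prod.fst e, congrArg Prod.snd e⟩
  conn A hA hA' := by
    obtain ⟨v, hv, w, hw, z, ⟨⟨p, q⟩, h, e⟩, ⟨p', q'⟩, h', e'⟩ := B.exists_meet_cells hconn A hA hA'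
    exact ⟨v, hv, w, hw, p, q, p', q', h, h', congrArg Prod.fst (e.trans e'.symm),
      congrArg Prod.snd (e.trans e'.symm)⟩

theorem cell_iff (hconn : IsConnected B.carpet) {w : B.D} {x y : ℝ} :
    (B.system hconn).Cell w x y ↔ (x, y) ∈ B.psi w '' B.carpet := by
  constructor
  · rintro ⟨p, q, h, e1, e2⟩
    exact ⟨(p, q), h, Prod.ext e1 e2⟩
  · rintro ⟨⟨p, q⟩, h, e⟩
    exact ⟨p, q, h, congrArg Prod.fst e, congrArg Prod.snd e⟩

theorem exists_ne_cell : ∃ v w : B.D, v ≠ w := by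
  have := Fintype.one_lt_card_iff.1 (by rw [Fintype.card_coe]; exact B.one_lt_card)
  exact this

/-- A one-point carpet would be a common fixed point of two distinct maps, but two cells can only
meet at points with opposite positions in some coordinate. -/
theorem exists_ne_mem_carpet (hconn : IsConnected B.carpet) (x : ℝ × ℝ) :
    ∃ y ∈ B.carpet, y ≠ x := by
  by_contra! h
  obtain ⟨v, w, hvw⟩ := B.exists_ne_cell
  obtain ⟨y, hy⟩ := B.carpet_nonempty
  have hx : (x.1, x.2) ∈ B.carpet := h y hy ▸ hy
  have e : ∀ w, B.psi w x = x := fun w => h _ (B.psi_mem w hx)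
  have e' := (e v).trans (e w).symm
  rcases CarpetSystem.meet_cases (S := B.system hconn) hvw hx hx (congrArg Prod.fst e')
    (congrArg Prod.snd e') with ⟨σ, -, h1, h2, -⟩ | ⟨σ, -, h1, h2, -⟩ | ⟨σ, τ, -, h1, h2, -⟩
  all_goals
    have := side_injective (h1.symm.trans h2)
    cases σ <;> simp at this

end BaranskiData

/-! ### Component sizes -/

/-- Turns the second entry of a sorted list into a count. Positivity of `m` keeps the default value
0 of `getD` from passing as an entry. -/
theorem two_le_countP_iff {m : ℕ} (hm : 0 < m) {l : List ℕ} (hl : l.Pairwise (· ≥ ·)) :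
    2 ≤ l.countP (fun n => decide (m ≤ n)) ↔ m ≤ l.getD 1 0 := by
  match l, hl with
  | [], _ => simp; omega
  | [a], _ =>
    have := List.countP_le_length (p := fun n => decide (m ≤ n)) (l := [a])
    simp only [List.length_singleton] at this
    simp only [List.getD_cons_succ, List.getD_nil]
    omega
  | a :: b :: t, hl =>
    rw [List.pairwise_cons, List.pairwise_cons] at hl
    have hab : b ≤ a := hl.1 b (by simp)
    simp only [List.getD_cons_succ, List.getD_cons_zero]
    constructor
    · intro h
      by_contra hb
      have ht : t.countP (fun n => decide (m ≤ n)) = 0 := by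
        rw [List.countP_eq_zero]
        intro x hx
        have := hl.2.1 x hx
        simp only [decide_eq_true_eq]
        omega
      rw [List.countP_cons, List.countP_cons, ht] at h
      simp only [hb, decide_false] at h
      split_ifs at h <;> simp_all
    · intro h
      rw [List.countP_cons, List.countP_cons]
      simp [h, h.trans hab]

theorem two_le_card_filter_iff {α : Type*} (s : Finset α) (f : α → ℕ) {m : ℕ} (hm : 0 < m) :
    (∃ a ∈ s, ∃ b ∈ s, a ≠ b ∧ m ≤ f a ∧ m ≤ f b) ↔
      m ≤ ((s.val.map f).sort (· ≥ ·)).getD 1 0 := by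
  classical
  rw [← two_le_countP_iff hm (Multiset.pairwise_sort _ _)]
  have h : ((s.val.map f).sort (· ≥ ·)).countP (fun n => decide (m ≤ n)) =
      (s.filter fun a => m ≤ f a).card := by
    rw [← Multiset.coe_countP, Multiset.sort_eq, Multiset.countP_map, Finset.card_def,
      Finset.filter_val]
  rw [h, ← Nat.lt_iff_add_one_le, Finset.one_lt_card]
  simp only [Finset.mem_filter]
  constructor
  · rintro ⟨a, ha, b, hb, hab, h1, h2⟩
    exact ⟨a, ⟨ha, h1⟩, b, ⟨hb, h2⟩, hab⟩
  · rintro ⟨a, ⟨ha, h1⟩, b, ⟨hb, h2⟩, hab⟩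
    exact ⟨a, ha, b, hb, hab, h1, h2⟩

namespace SimpleGraph

variable {V : Type*}

theorem le_chi_iff [Fintype V] (G : SimpleGraph V) {m : ℕ} (hm : 0 < m) :
    m ≤ G.chi ↔ ∃ v, ∃ c c' : (G.deleteVertex v).ConnectedComponent, c ≠ c' ∧
      m ≤ c.supp.ncard ∧ m ≤ c'.supp.ncard := by
  classical
  rw [chi, Finset.le_sup_iff (show ⊥ < m from hm)]
  constructor
  · rintro ⟨v, -, h⟩
    rw [componentSizes, ← two_le_card_filter_iff _ _ hm] at h
    obtain ⟨c, -, c', -, h⟩ := h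
    exact ⟨v, c, c', h⟩
  · rintro ⟨v, c, c', hne, h, h'⟩
    refine ⟨v, ?_, ?_⟩
    · rw [Finset.mem_filter]
      refine ⟨Finset.mem_univ _, fun hpre => hne ?_⟩
      have := hpre.subsingleton_connectedComponent
      exact Subsingleton.elim _ _
    · rw [componentSizes, ← two_le_card_filter_iff _ _ hm]
      exact ⟨c, @Finset.mem_univ _ (_) c, c', @Finset.mem_univ _ (_) c', hne, h, h'⟩

/-- The property `P` is preserved along the edges of `G - {v}`. -/
def InvariantOff (G : SimpleGraph V) (v : V) (P : V → Prop) : Prop :=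
  ∀ a b, a ≠ v → b ≠ v → G.Adj a b → P a → P b

/-- The set `S` lies in one component of `G - {v}`. -/
def LinkedOff (G : SimpleGraph V) (v : V) (S : Set V) : Prop :=
  v ∉ S ∧ ∀ P, G.InvariantOff v P → ∀ a ∈ S, ∀ b ∈ S, P a → P b

theorem InvariantOff.not {G : SimpleGraph V} {v : V} {P : V → Prop} (h : G.InvariantOff v P) :
    G.InvariantOff v fun a => ¬ P a :=
  fun a b ha hb hab hPa hPb => hPa (h b a hb ha hab.symm hPb)

theorem Reachable.property {G : SimpleGraph V} {P : V → Prop}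
    (h : ∀ a b, G.Adj a b → P a → P b) {a b : V} (hab : G.Reachable a b) (ha : P a) : P b := by
  obtain ⟨p⟩ := hab
  induction p with
  | nil => exact ha
  | cons h' _ ih => exact ih (h _ _ h' ha)

theorem LinkedOff.exists_component {G : SimpleGraph V} {v : V} {S : Set V} [Finite V]
    (h : G.LinkedOff v S) {a : V} (ha : a ∈ S) :
    ∃ c : (G.deleteVertex v).ConnectedComponent,
      (∃ h : a ≠ v, (G.deleteVertex v).connectedComponentMk ⟨a, h⟩ = c) ∧
      S.ncard ≤ c.supp.ncard := by
  have hav : a ≠ v := fun e => h.1 (e ▸ ha)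
  refine ⟨_, ⟨hav, rfl⟩, ?_⟩
  rw [← Set.ncard_image_of_injective _ Subtype.val_injective]
  refine Set.ncard_le_ncard (fun b hb => ?_) (Set.toFinite _)
  refine h.2 (fun b => b ∈ Subtype.val ''
    ((G.deleteVertex v).connectedComponentMk ⟨a, hav⟩).supp) ?_ a ha b hb ⟨⟨a, hav⟩, rfl, rfl⟩
  rintro _ b - hb hab ⟨⟨c, hc⟩, hcs, rfl⟩
  refine ⟨⟨b, hb⟩, ?_, rfl⟩
  rw [ConnectedComponent.mem_supp_iff] at hcs ⊢
  rw [← hcs]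
  exact ConnectedComponent.sound (Adj.reachable (show (G.deleteVertex v).Adj _ _ from hab.symm))

/-- The form in which all lower bounds for `chi` are obtained: `P` puts `S` and `T` into different
components of `G - {v}`, so these components need not be identified. -/
theorem le_chi_of_linkedOff [Fintype V] {G : SimpleGraph V} {v : V} {P : V → Prop}
    (hP : G.InvariantOff v P) {S T : Set V} (hS : G.LinkedOff v S) (hT : G.LinkedOff v T)
    (hSP : ∀ a ∈ S, P a) (hTP : ∀ a ∈ T, ¬ P a) {m : ℕ} (hmS : m ≤ S.ncard)
    (hmT : m ≤ T.ncard) : m ≤ G.chi := by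
  rcases Nat.eq_zero_or_pos m with rfl | hm
  · exact Nat.zero_le _
  obtain ⟨a, ha⟩ := Set.nonempty_of_ncard_ne_zero (hm.trans_le hmS).ne'
  obtain ⟨b, hb⟩ := Set.nonempty_of_ncard_ne_zero (hm.trans_le hmT).ne'
  obtain ⟨c, ⟨hav, rfl⟩, hc⟩ := hS.exists_component ha
  obtain ⟨c', ⟨hbv, rfl⟩, hc'⟩ := hT.exists_component hb
  refine (G.le_chi_iff hm).2 ⟨v, _, _, fun e => hTP b hb ?_, hmS.trans hc, hmT.trans hc'⟩
  exact (ConnectedComponent.exact e).property (P := fun x => P x.1)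
    (fun x y hxy => hP _ _ x.2 y.2 hxy) (hSP a ha)

theorem exists_invariantOff_of_le_chi [Fintype V] {G : SimpleGraph V} {m : ℕ} (hm : 0 < m)
    (h : m ≤ G.chi) : ∃ v, ∃ C C' : Set V, Disjoint C C' ∧ v ∉ C ∧ v ∉ C' ∧
      G.InvariantOff v (· ∈ C) ∧ G.InvariantOff v (· ∈ C') ∧ m ≤ C.ncard ∧ m ≤ C'.ncard := by
  obtain ⟨v, c, c', hne, hc, hc'⟩ := (G.le_chi_iff hm).1 h
  have hinv : ∀ c : (G.deleteVertex v).ConnectedComponent,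
      G.InvariantOff v (· ∈ Subtype.val '' c.supp) := by
    rintro c _ b - hb hab ⟨⟨a, ha⟩, hcs, rfl⟩
    refine ⟨⟨b, hb⟩, ?_, rfl⟩
    rw [ConnectedComponent.mem_supp_iff] at hcs ⊢
    rw [← hcs]
    exact ConnectedComponent.sound (Adj.reachable (show (G.deleteVertex v).Adj _ _ from hab.symm))
  refine ⟨v, Subtype.val '' c.supp, Subtype.val '' c'.supp, ?_, ?_, ?_, hinv c, hinv c', ?_, ?_⟩
  · rw [Set.disjoint_image_iff Subtype.val_injective, Set.disjoint_left]
    intro x hx hx'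
    rw [ConnectedComponent.mem_supp_iff] at hx hx'
    exact hne (hx.symm.trans hx')
  · rintro ⟨x, -, hx⟩
    exact x.2 hx
  · rintro ⟨x, -, hx⟩
    exact x.2 hx
  · rwa [Set.ncard_image_of_injective _ Subtype.val_injective]
  · rwa [Set.ncard_image_of_injective _ Subtype.val_injective]

end SimpleGraph

/-! ### Connectedness of the Hata graphs -/

namespace BaranskiData

variable {B : BaranskiData}

/-- Connectedness of `Γ_k`: a connected `K` covered by finitely many compact cylinders cannot be
divided into two families of cylinders that do not touch. -/
theorem hataGraph_invariant (hconn : IsConnected B.carpet) {k : ℕ} {P : (Fin k → B.D) → Prop}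
    (hP : ∀ a b, (B.hataGraph k).Adj a b → P a → P b) {a b : Fin k → B.D} (ha : P a) : P b := by
  by_contra hb
  obtain ⟨u, hu, w, hw, h⟩ := B.exists_meet_of_cover hconn (fun u : Fin k → B.D => B.cyl u)
    (fun u => (B.isCompact_cyl u).isClosed) (fun u => B.cyl_nonempty u)
    (fun u => B.cyl_subset u)
    (fun x hx => Set.mem_iUnion.2 (B.exists_mem_cyl k hx)) {u | P u} ⟨a, ha⟩ ⟨b, hb⟩
  exact hw (hP u w ⟨fun e => hw (e ▸ hu), h⟩ hu)

theorem hataGraph_adj_cons {k : ℕ} (d : B.D) {u w : Fin k → B.D} (h : (B.hataGraph k).Adj u w) :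
    (B.hataGraph (k + 1)).Adj (Fin.cons d u) (Fin.cons d w) := by
  refine ⟨fun e => h.1 (Fin.cons_right_injective (α := fun _ => B.D) d e), ?_⟩
  obtain ⟨x, hx, hx'⟩ := h.2
  refine ⟨B.psi d x, ?_, ?_⟩
  · change _ ∈ B.cyl _
    rw [cyl_cons]
    exact ⟨x, hx, rfl⟩
  · change _ ∈ B.cyl _
    rw [cyl_cons]
    exact ⟨x, hx', rfl⟩

/-- The words with first letter `d`. -/
def block (B : BaranskiData) (k : ℕ) (d : B.D) : Set (Fin (k + 1) → B.D) :=
  Set.range fun u : Fin k → B.D => (Fin.cons d u : Fin (k + 1) → B.D)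

theorem mem_block {k : ℕ} {d : B.D} {u : Fin (k + 1) → B.D} : u ∈ B.block k d ↔ u 0 = d := by
  constructor
  · rintro ⟨w, rfl⟩
    simp
  · rintro rfl
    exact ⟨Fin.tail u, Fin.cons_self_tail u⟩

theorem ncard_words (k : ℕ) : Nat.card (Fin k → B.D) = B.D.card ^ k := by
  simp

theorem ncard_block (k : ℕ) (d : B.D) : (B.block k d).ncard = B.D.card ^ k := by
  rw [block, ← Set.image_univ, Set.ncard_image_of_injective _
    (Fin.cons_right_injective (α := fun _ => B.D) d), Set.ncard_univ, ncard_words]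

/-- Prefixing `d` embeds the connected graph `Γ_k` into the block, which does not contain `v`. -/
theorem linkedOff_block (hconn : IsConnected B.carpet) {k : ℕ} {d : B.D} {v : Fin (k + 1) → B.D}
    (hd : v 0 ≠ d) : (B.hataGraph (k + 1)).LinkedOff v (B.block k d) := by
  have hne : ∀ u : Fin k → B.D, (Fin.cons d u : Fin (k + 1) → B.D) ≠ v := by
    rintro u rfl
    exact hd (by simp)
  refine ⟨fun h => hd (mem_block.1 h), ?_⟩
  rintro P hP _ ⟨a, rfl⟩ _ ⟨b, rfl⟩ h
  exact hataGraph_invariant hconn (P := fun u => P (Fin.cons d u))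
    (fun a b hab => hP _ _ (hne a) (hne b) (hataGraph_adj_cons d hab)) h

theorem exists_adj_of_mem {k : ℕ} {d d' : B.D} (hne : d ≠ d') {x x' : ℝ × ℝ}
    {u u' : Fin k → B.D} (hu : x ∈ B.cyl u) (hu' : x' ∈ B.cyl u') (h : B.psi d x = B.psi d' x') :
    (B.hataGraph (k + 1)).Adj (Fin.cons d u) (Fin.cons d' u') := by
  refine ⟨fun e => hne (by simpa using congrFun e 0), B.psi d x, ?_, ?_⟩
  · change _ ∈ B.cyl _
    rw [cyl_cons]
    exact ⟨x, hu, rfl⟩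
  · change _ ∈ B.cyl _
    rw [cyl_cons, h]
    exact ⟨x', hu', rfl⟩

theorem le_chi_of_blocks (hconn : IsConnected B.carpet) {k : ℕ} {v : Fin (k + 1) → B.D}
    {P : (Fin (k + 1) → B.D) → Prop} (hP : (B.hataGraph (k + 1)).InvariantOff v P) {d d' : B.D}
    (hd : v 0 ≠ d) (hd' : v 0 ≠ d') (hPd : ∀ u ∈ B.block k d, P u)
    (hPd' : ∀ u ∈ B.block k d', ¬ P u) : B.D.card ^ k ≤ (B.hataGraph (k + 1)).chi :=
  SimpleGraph.le_chi_of_linkedOff hP (linkedOff_block hconn hd) (linkedOff_block hconn hd') hPd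
    hPd' (ncard_block k d).ge (ncard_block k d').ge

/-! ### Large components from tails and pinch points -/

/-- If the carpet minus the cell `e` is connected and the contact points of `e` are not in `e e`,
then all Hata graphs stay connected when the word `e e ⋯ e` is removed. -/
theorem linkedOff_compl_const (hconn : IsConnected B.carpet) {e : B.D}
    (h1 : ∀ p q, (B.system hconn).Contact e p q → ¬ (B.system hconn).Cell e p q)
    (h2 : (B.system hconn).ConnectedOff e) (k : ℕ) :
    (B.hataGraph k).LinkedOff (fun _ => e) {fun _ => e}ᶜ := by
  induction k with
  | zero => exact ⟨by simp, fun P _ a ha => absurd (Subsingleton.elim _ _) ha⟩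
  | succ k ih =>
    have hcons : (fun _ => e : Fin (k + 1) → B.D) = Fin.cons e fun _ => e := by
      rw [← Fin.cons_self_tail (fun _ => e : Fin (k + 1) → B.D)]
      rfl
    have hcons_ne : ∀ {d} {u : Fin k → B.D}, d ≠ e →
        (Fin.cons d u : Fin (k + 1) → B.D) ≠ fun _ => e := fun {d u} hd h =>
      hd (by simpa using congrFun h 0)
    refine ⟨by simp, ?_⟩
    -- Both `P` and its negation are invariant, so if they held at different words each would hold
    -- on every block other than that of `e`.
    suffices h : ∀ P, (B.hataGraph (k + 1)).InvariantOff (fun _ => e) P →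
        ∀ a, a ≠ (fun _ => e) → P a → ∀ d, d ≠ e → ∀ u, P (Fin.cons d u) by
      intro P hP a ha b hb hPa
      by_contra hPb
      obtain ⟨v, w, hvw⟩ := B.exists_ne_cell
      obtain ⟨d, hd⟩ : ∃ d, d ≠ e := by
        by_cases hv : v = e
        · exact ⟨w, fun h => hvw (hv.trans h.symm)⟩
        · exact ⟨v, hv⟩
      exact h _ hP.not b hb hPb d hd (fun _ => e) (h P hP a ha hPa d hd fun _ => e)
    intro P hP a ha hPa
    have inblock : ∀ {d}, d ≠ e → ∀ {u w : Fin k → B.D}, P (Fin.cons d u) → P (Fin.cons d w) :=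
      fun {d} hd {u w} h =>
        (linkedOff_block hconn (k := k) (v := fun _ => e) hd.symm).2 P hP _
          (mem_block.2 (by simp)) _ (mem_block.2 (by simp)) h
    obtain ⟨d, hd, hPd⟩ : ∃ d, d ≠ e ∧ ∀ u, P (Fin.cons d u) := by
      by_cases ha0 : a 0 = e
      · have hat : Fin.tail a ≠ fun _ => e := by
          intro h
          apply ha
          rw [← Fin.cons_self_tail a, ha0, h, ← hcons]
        obtain ⟨e', he', d, hd, z, ⟨x, hx, rfl⟩, y, hy, hxy⟩ := B.exists_meet_cells hconn {e}
          ⟨e, rfl⟩ (by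
            obtain ⟨v, w, hvw⟩ := B.exists_ne_cell
            by_cases hv : v = e
            · exact ⟨w, fun h => hvw (hv.trans (Eq.symm h))⟩
            · exact ⟨v, hv⟩)
        rw [Set.mem_singleton_iff.1 he'] at hxy
        -- From inside the block of `e` one leaves through a contact point; it is not in `e e`, so
        -- the word reaching it is not the removed one and the induction hypothesis connects to it.
        obtain ⟨u, hu⟩ := B.exists_mem_cyl k hx
        obtain ⟨w, hw⟩ := B.exists_mem_cyl k hy
        have hu' : u ≠ fun _ => e := by
          rintro rfl
          cases k with
          | zero => exact hat (Subsingleton.elim _ _)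
          | succ k =>
            exact h1 x.1 x.2 ⟨hx, d, hd, (B.cell_iff hconn).2 ⟨y, hy, hxy⟩⟩
              ((B.cell_iff hconn).2 (B.cyl_subset_psi _ hu))
        have hPu : P (Fin.cons e u) := by
          refine ih.2 (fun u => P (Fin.cons e u)) ?_ (Fin.tail a) hat u hu' ?_
          · intro b c hb hc hbc
            refine hP _ _ ?_ ?_ (hataGraph_adj_cons e hbc)
            · rw [hcons]
              exact fun h => hb (Fin.cons_right_injective (α := fun _ => B.D) e h)
            · rw [hcons]
              exact fun h => hc (Fin.cons_right_injective (α := fun _ => B.D) e h)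
          · rw [← ha0, Fin.cons_self_tail]
            exact hPa
        refine ⟨d, hd, fun u' => inblock hd (u := w) ?_⟩
        refine hP _ _ ?_ (hcons_ne hd) (exists_adj_of_mem (Ne.symm hd) hu hw hxy.symm) hPu
        rw [hcons]
        exact fun h => hu' (Fin.cons_right_injective (α := fun _ => B.D) e h)
      · refine ⟨a 0, ha0, fun u => inblock ha0 (u := Fin.tail a) ?_⟩
        rwa [Fin.cons_self_tail]
    intro d' hd' u
    by_contra hPu
    obtain ⟨v, hv, w, hw, hve, hwe, x, y, hc, hc'⟩ := h2 {d | ∀ u, P (Fin.cons d u)} ⟨d, hPd, hd⟩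
      ⟨d', fun h => hPu (h u), hd'⟩
    obtain ⟨z, hz, hzx⟩ := (B.cell_iff hconn).1 hc
    obtain ⟨z', hz', hzx'⟩ := (B.cell_iff hconn).1 hc'
    obtain ⟨u, hu⟩ := B.exists_mem_cyl k hz
    obtain ⟨u', hu'⟩ := B.exists_mem_cyl k hz'
    refine hw fun u'' => inblock hwe (u := u') ?_
    exact hP _ _ (hcons_ne hve) (hcons_ne hwe)
      (exists_adj_of_mem (d := v) (d' := w) (fun e => hw (e ▸ hv)) hu hu'
        (hzx.trans hzx'.symm)) (hv u)

/-- All contacts of the cell `v` go through the word `v e ⋯ e`. Its removal isolates the remaining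
`|D|^k - 1` words of the block of `v`, which stay linked, from the block of any other letter. -/
theorem le_chi_of_isTail (hconn : IsConnected B.carpet) {v e : B.D}
    (h : (B.system hconn).IsTail v e) (k : ℕ) :
    B.D.card ^ k - 1 ≤ (B.hataGraph (k + 1)).chi := by
  obtain ⟨⟨T, hT, hT'⟩, h1, h2⟩ := h
  have hword : ∀ {k} {u : Fin k → B.D} {p q}, T p q → (p, q) ∈ B.cyl u → u = fun _ => e := by
    intro k
    induction k with
    | zero => intros; exact Subsingleton.elim _ _
    | succ k ih =>
      intro u p q ht hu
      rw [cyl_succ] at hu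
      obtain ⟨⟨p', q'⟩, hu', hpq⟩ := hu
      have hK := B.cyl_subset _ hu'
      obtain ⟨h3, h4⟩ := hT' (u 0) p' q' hK (by
        have e1 : (B.system hconn).X.g (u 0) p' = p := congrArg Prod.fst hpq
        have e2 : (B.system hconn).Y.g (u 0) q' = q := congrArg Prod.snd hpq
        rwa [e1, e2])
      rw [← Fin.cons_self_tail u, h3, ih h4 hu']
      exact Fin.cons_self_tail (fun _ => e : Fin (k + 1) → B.D)
  obtain ⟨d, hd⟩ : ∃ d, d ≠ v := by
    obtain ⟨a, b, hab⟩ := B.exists_ne_cell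
    by_cases ha : a = v
    · exact ⟨b, fun h => hab (ha.trans h.symm)⟩
    · exact ⟨a, ha⟩
  have hinj := Fin.cons_right_injective (n := k) (α := fun _ => B.D) v
  refine SimpleGraph.le_chi_of_linkedOff (v := Fin.cons v fun _ => e) (P := fun u => u 0 = v)
    (S := (fun u : Fin k → B.D => (Fin.cons v u : Fin (k + 1) → B.D)) '' {fun _ => e}ᶜ)
    (T := B.block k d) ?_ ⟨?_, ?_⟩ (linkedOff_block hconn (by simpa using hd.symm)) ?_ ?_ ?_ ?_
  · intro a b ha _ hab ha0
    by_contra hb0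
    obtain ⟨z, hz, hz'⟩ := hab.2
    change z ∈ B.cyl a at hz
    change z ∈ B.cyl b at hz'
    rw [cyl_succ] at hz
    obtain ⟨⟨p, q⟩, hpq, rfl⟩ := hz
    apply ha
    have htail : Fin.tail a = fun _ => e := by
      refine hword (hT p q ⟨B.cyl_subset _ hpq, b 0, hb0, ?_⟩) hpq
      rw [cell_iff]
      rw [ha0] at hz'
      exact B.cyl_subset_psi b hz'
    rw [← Fin.cons_self_tail a, ha0, htail]
  · rintro ⟨u, hu, h⟩
    exact hu (hinj h)
  · rintro P hP _ ⟨a, ha, rfl⟩ _ ⟨b, hb, rfl⟩ hPa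
    refine (linkedOff_compl_const hconn h1 h2 k).2 (fun u => P (Fin.cons v u)) ?_ a ha b hb hPa
    intro a b ha hb hab
    exact hP _ _ (fun h => ha (hinj h)) (fun h => hb (hinj h)) (hataGraph_adj_cons v hab)
  · rintro _ ⟨u, -, rfl⟩
    simp
  · rintro u hu h
    exact hd ((mem_block.1 hu).symm.trans h)
  · rw [Set.ncard_image_of_injective _ hinj, Set.ncard_compl, Set.ncard_singleton, ncard_words]
  · rw [ncard_block]
    exact Nat.sub_le _ _

theorem exists_unique_word_of_tame (hconn : IsConnected B.carpet) (k : ℕ) {p q : ℝ}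
    (h : (B.system hconn).Tame p q) : ∃ u : Fin k → B.D, ∀ w, (p, q) ∈ B.cyl w → w = u := by
  induction k generalizing p q with
  | zero => exact ⟨Fin.elim0, fun _ _ => Subsingleton.elim _ _⟩
  | succ k ih =>
    obtain ⟨d, p', q', ht, hp, hq, hd⟩ := h.step
    obtain ⟨u, hu⟩ := ih ht
    refine ⟨Fin.cons d u, fun w hw => ?_⟩
    have hw0 : w 0 = d := hd _ ((B.cell_iff hconn).2 (B.cyl_subset_psi w hw))
    rw [cyl_succ] at hw
    obtain ⟨z, hz, hzx⟩ := hw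
    have e : z = (p', q') := B.psi_injective (w 0) (hzx.trans (by
      rw [hw0]
      exact (Prod.ext hp hq : B.psi d (p', q') = (p, q)).symm))
    have htail : Fin.tail w = u := hu _ (e ▸ hz)
    rw [← Fin.cons_self_tail w, hw0, htail]

/-- Only the word `v u`, with `u` the unique address of the tame position, reaches the pinch point
from within `A`. Removing it separates `A` from its complement and leaves the blocks of `w` and `d`
whole. -/
theorem le_chi_of_pinchedAt (hconn : IsConnected B.carpet) {A : Set B.D} {x y : ℝ} {v w : B.D}
    (h : (B.system hconn).PinchedAt A x y v) (hw : w ∈ A) (hwv : w ≠ v) (k : ℕ) :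
    B.D.card ^ k ≤ (B.hataGraph (k + 1)).chi := by
  obtain ⟨hP, hv, ⟨p, q, hK, hp, hq⟩, hun⟩ := h
  obtain ⟨d, hd⟩ := hP.2.1
  obtain ⟨u, hu⟩ := exists_unique_word_of_tame hconn k (hP.tame hv hK hp hq)
  refine le_chi_of_blocks hconn (v := Fin.cons v u) (P := fun a => a 0 ∈ A) (d := w) (d' := d)
    ?_ (by simpa using hwv.symm) (by rintro rfl; exact hd (by simpa using hv)) ?_ ?_
  · intro a b ha _ hab ha0
    by_contra hb0
    obtain ⟨z, hz, hz'⟩ := hab.2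
    change z ∈ B.cyl a at hz
    change z ∈ B.cyl b at hz'
    have c1 := (B.cell_iff hconn).2 (B.cyl_subset_psi a hz)
    have c2 := (B.cell_iff hconn).2 (B.cyl_subset_psi b hz')
    obtain ⟨e1, e2⟩ := hP.2.2 _ ha0 _ hb0 _ _ c1 c2
    rw [e1, e2] at c1
    have ha0v := hun _ ha0 c1
    rw [cyl_succ] at hz
    obtain ⟨z', hz', hzz⟩ := hz
    have e : z' = (p, q) := B.psi_injective (a 0) (hzz.trans (by
      rw [ha0v]
      exact (Prod.ext (e1.trans hp.symm) (e2.trans hq.symm) : z = B.psi v (p, q))))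
    have htail : Fin.tail a = u := hu _ (e ▸ hz')
    exact ha (by rw [← Fin.cons_self_tail a, ha0v, htail])
  · intro a ha
    rw [mem_block.1 ha]
    exact hw
  · intro a ha
    rw [mem_block.1 ha]
    exact hd

end BaranskiData

/-! ### Confined cells in the absence of pinched partitions -/

namespace CarpetSystem

variable {D : Type*} {S : CarpetSystem D}

theorem exists_contact (a : D) (h : ∃ w, w ≠ a) : ∃ p q, S.Contact a p q := by
  obtain ⟨w, hw⟩ := h
  obtain ⟨v, rfl, w, hw, p, q, p', q', hK, hK', hp, hq⟩ := S.conn {a} ⟨a, rfl⟩ ⟨w, hw⟩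
  exact ⟨p, q, hK, w, hw, p', q', hK', hp.symm, hq.symm⟩

/-- A cell with a single contact point is one part of a pinched partition. -/
theorem pinched_singleton {a : D} (h : ∃ w, w ≠ a) (hs : ∀ p q p' q', S.Contact a p q →
    S.Contact a p' q' → p = p' ∧ q = q') : ∃ x y, S.Pinched {a} x y := by
  obtain ⟨p, q, hpq⟩ := S.exists_contact a h
  obtain ⟨w, hw⟩ := h
  refine ⟨S.X.g a p, S.Y.g a q, ⟨a, rfl⟩, ⟨w, hw⟩, ?_⟩
  rintro _ rfl u hu x' y' ⟨p', q', hK, rfl, rfl⟩ hc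
  obtain ⟨rfl, rfl⟩ := hs _ _ _ _ ⟨hK, u, hu, hc⟩ hpq
  exact ⟨rfl, rfl⟩

/-- If the carpet has no pinched partition and `a` is confined to `b`, then the fixed point of `b`
is a contact point of `a`, and `b` is not confined. -/
theorem Confined.exists_contact_fixed {a b : D} (hD : ∃ v w : D, v ≠ w)
    (hno : ¬ ∃ A x y, S.Pinched A x y) (hab : S.Confined a b) :
    (∃ p q, S.Contact a p q ∧ S.X.g b p = p ∧ S.Y.g b q = q) ∧ ∀ b', ¬ S.Confined b b' := by
  have hne : ∀ a : D, ∃ w, w ≠ a := by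
    obtain ⟨v, w, hvw⟩ := hD
    intro a
    by_cases hv : v = a
    · exact ⟨w, fun h => hvw (hv.trans h.symm)⟩
    · exact ⟨v, hv⟩
  have htwo : ∀ a, ∃ p q p' q', S.Contact a p q ∧ S.Contact a p' q' ∧ ¬ (p = p' ∧ q = q') := by
    intro a
    by_contra! hs
    obtain ⟨x, y, h⟩ := pinched_singleton (S := S) (hne a) fun p q p' q' h h' =>
      ⟨(hs p q p' q' h h').1, (hs p q p' q' h h').2⟩
    exact hno ⟨_, x, y, h⟩
  obtain ⟨p, q, p', q', h, h', hpq⟩ := htwo a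
  obtain ⟨r, s, r', s', hb, hb', hrs⟩ := htwo b
  rcases hab.exists_facing h h' hpq with ⟨σ, w, hr, t, t', ht, ht', htt⟩ |
    ⟨σ, w, hr, t, t', ht, ht', htt⟩
  · exact ⟨hab.exists_fixed_contact hr ht ht' htt, fun b' hbb =>
      hrs (hab.subsingleton_contact hr ht ht' htt hbb hb hb')⟩
  · obtain ⟨p, q, h1, h2, h3⟩ := hab.swap.exists_fixed_contact hr ht ht' htt
    exact ⟨⟨q, p, S.swap_contact.1 h1, h3, h2⟩, fun b' hbb =>
      hrs (hab.swap.subsingleton_contact hr ht ht' htt hbb.swap (S.swap_contact.2 hb)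
        (S.swap_contact.2 hb')).symm⟩

end CarpetSystem

namespace BaranskiData

variable {B : BaranskiData}

/-! ### Splittings of the carpet at a cut point -/

/-- `E` and `F` are closed sets with union `K` that meet at most in `x ∈ K`, and each of them
contains a point other than `x`. -/
def IsSplit (B : BaranskiData) (x : ℝ × ℝ) (E F : Set (ℝ × ℝ)) : Prop :=
  x ∈ B.carpet ∧ IsClosed E ∧ IsClosed F ∧ E ∪ F = B.carpet ∧ E ∩ F ⊆ {x} ∧
    (∃ y ∈ E, y ≠ x) ∧ ∃ y ∈ F, y ≠ x

theorem IsSplit.symm {x : ℝ × ℝ} {E F : Set (ℝ × ℝ)} (h : B.IsSplit x E F) : B.IsSplit x F E := by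
  obtain ⟨h1, h2, h3, h4, h5, h6, h7⟩ := h
  exact ⟨h1, h3, h2, by rwa [Set.union_comm], by rwa [Set.inter_comm], h7, h6⟩

theorem exists_isSplit_of_isCutPoint {x : ℝ × ℝ} (h : IsCutPoint B.carpet x) :
    ∃ E F, B.IsSplit x E F := by
  obtain ⟨hx, h⟩ := h
  rw [isPreconnected_iff_subset_of_disjoint] at h
  push Not at h
  obtain ⟨u, v, hu, hv, hcov, hdisj, h1, h2⟩ := h
  have hK := B.isCompact_carpet.isClosed
  refine ⟨(B.carpet \ v) ∪ {x}, (B.carpet \ u) ∪ {x}, hx,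
    (hK.sdiff hv).union isClosed_singleton, (hK.sdiff hu).union isClosed_singleton, ?_, ?_, ?_, ?_⟩
  · apply Set.Subset.antisymm
    · rintro y ((⟨hy, -⟩ | rfl) | (⟨hy, -⟩ | rfl)) <;> assumption
    · intro y hy
      by_cases hyx : y = x
      · exact Or.inl (Or.inr hyx)
      by_cases hyv : y ∈ v
      · refine Or.inr (Or.inl ⟨hy, fun hyu => ?_⟩)
        exact (hdisj ▸ (⟨⟨hy, hyx⟩, hyu, hyv⟩ : y ∈ (B.carpet \ {x}) ∩ (u ∩ v)) : y ∈ (∅ : Set _))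
      · exact Or.inl (Or.inl ⟨hy, hyv⟩)
  · rintro y ⟨⟨hy, hyv⟩ | hyx, ⟨-, hyu⟩ | hyx'⟩
    · by_contra hyx
      exact (hcov ⟨hy, hyx⟩).elim hyu hyv
    · exact hyx'
    · exact hyx
    · exact hyx
  · obtain ⟨y, ⟨hy, hyx⟩, hyv⟩ := Set.not_subset.1 h2
    exact ⟨y, Or.inl ⟨hy, hyv⟩, hyx⟩
  · obtain ⟨y, ⟨hy, hyx⟩, hyu⟩ := Set.not_subset.1 h1
    exact ⟨y, Or.inl ⟨hy, hyu⟩, hyx⟩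

/-- The part of `K` which is mapped into `E` by `ψ_v`. -/
def pull (B : BaranskiData) (v : B.D) (E : Set (ℝ × ℝ)) : Set (ℝ × ℝ) := B.psi v ⁻¹' E ∩ B.carpet

theorem inter_nonempty_of_union (hconn : IsConnected B.carpet) {E F : Set (ℝ × ℝ)}
    (hE : IsClosed E) (hF : IsClosed F) (hEF : E ∪ F = B.carpet) (hE0 : E.Nonempty)
    (hF0 : F.Nonempty) : (E ∩ F).Nonempty := by
  obtain ⟨x, hx⟩ := hE0
  obtain ⟨y, hy⟩ := hF0
  obtain ⟨z, -, hz⟩ := isPreconnected_closed_iff.1 hconn.isPreconnected E F hE hF hEF.ge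
    ⟨x, hEF ▸ Or.inl hx, hx⟩ ⟨y, hEF ▸ Or.inr hy, hy⟩
  exact ⟨z, hz⟩

/-- A cell lies on one side of a splitting or is itself split. -/
theorem IsSplit.cell_cases (hconn : IsConnected B.carpet) {x : ℝ × ℝ} {E F : Set (ℝ × ℝ)}
    (h : B.IsSplit x E F) (w : B.D) : B.psi w '' B.carpet ⊆ E ∨ B.psi w '' B.carpet ⊆ F ∨
      ∃ x', B.psi w x' = x ∧ B.IsSplit x' (B.pull w E) (B.pull w F) := by
  have hcl : ∀ {G}, IsClosed G → IsClosed (B.pull w G) := fun hG =>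
    (hG.preimage (B.psi_continuous w)).inter B.isCompact_carpet.isClosed
  -- Here the part of the cell in `E` is at most one point. By connectedness of `K` this point is
  -- not isolated from the part in `F`, hence belongs to `F`.
  have side : ∀ {E F}, B.IsSplit x E F → (∀ y ∈ B.pull w E, B.psi w y = x) →
      B.psi w '' B.carpet ⊆ F := by
    rintro E F ⟨-, hE, hF, hEF, hi, -⟩ hall _ ⟨y, hy, rfl⟩
    have hcov : B.pull w E ∪ B.pull w F = B.carpet := by
      rw [pull, pull, ← Set.union_inter_distrib_right, ← Set.preimage_union, hEF,
        Set.inter_eq_right]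
      exact fun z hz => B.psi_mem w hz
    by_contra hyF
    have hyE : y ∈ B.pull w E := (hcov.ge hy).resolve_right fun h => hyF h.1
    obtain ⟨z, hz, hzy⟩ := B.exists_ne_mem_carpet hconn y
    have hzF : z ∈ B.pull w F := (hcov.ge hz).resolve_left fun h =>
      hzy (B.psi_injective w ((hall z h).trans (hall y hyE).symm))
    obtain ⟨t, htE, htF⟩ := inter_nonempty_of_union hconn (hcl hE) (hcl hF) hcov ⟨y, hyE⟩ ⟨z, hzF⟩
    obtain rfl := B.psi_injective w ((hall t htE).trans (hall y hyE).symm)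
    exact hyF htF.1
  by_cases h1 : ∀ y ∈ B.pull w E, B.psi w y = x
  · exact Or.inr (Or.inl (side h h1))
  by_cases h2 : ∀ y ∈ B.pull w F, B.psi w y = x
  · exact Or.inl (side h.symm h2)
  push Not at h1 h2
  obtain ⟨y, hy, hyx⟩ := h1
  obtain ⟨z, hz, hzx⟩ := h2
  obtain ⟨-, hE, hF, hEF, hi, -⟩ := h
  have hcov : B.pull w E ∪ B.pull w F = B.carpet := by
    rw [pull, pull, ← Set.union_inter_distrib_right, ← Set.preimage_union, hEF,
      Set.inter_eq_right]
    exact fun z hz => B.psi_mem w hz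
  obtain ⟨t, htE, htF⟩ := inter_nonempty_of_union hconn (hcl hE) (hcl hF) hcov ⟨y, hy⟩ ⟨z, hz⟩
  have htx : B.psi w t = x := hi ⟨htE.1, htF.1⟩
  refine Or.inr (Or.inr ⟨t, htx, htE.2, hcl hE, hcl hF, hcov, fun s hs => ?_, ⟨y, hy, ?_⟩,
    ⟨z, hz, ?_⟩⟩)
  · exact B.psi_injective w ((hi ⟨hs.1.1, hs.2.1⟩ : B.psi w s = x).trans htx.symm)
  · rintro rfl
    exact hyx htx
  · rintro rfl
    exact hzx htx

open scoped Classical in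
/-- The number of coordinates of a point that are `0` or `1`. -/
noncomputable def endCount (x : ℝ × ℝ) : ℕ :=
  (if ∃ σ, x.1 = side σ then 1 else 0) + if ∃ σ, x.2 = side σ then 1 else 0

theorem endCount_le_two (x : ℝ × ℝ) : endCount x ≤ 2 := by
  unfold endCount
  split_ifs <;> omega

/-- A contact lies on an inner grid line: one coordinate is an endpoint within the cell but not in
`K`. No coordinate becomes an endpoint under `ψ_v`. -/
theorem endCount_lt (hconn : IsConnected B.carpet) {v w : B.D} (hvw : v ≠ w) {x y : ℝ × ℝ}
    (hx : x ∈ B.carpet) (hy : y ∈ B.carpet) (h : B.psi v x = B.psi w y) :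
    endCount (B.psi v x) < endCount x := by
  let S := B.system hconn
  have h1 : (∃ σ, (B.psi v x).1 = side σ) → ∃ σ, x.1 = side σ := fun ⟨σ, e⟩ =>
    ⟨σ, (S.X.eq_side_of_g (w := v) (S.mem_left hx) e).2⟩
  have h2 : (∃ σ, (B.psi v x).2 = side σ) → ∃ σ, x.2 = side σ := fun ⟨σ, e⟩ =>
    ⟨σ, (S.Y.eq_side_of_g (w := v) (S.mem_right hx) e).2⟩
  have h3 : (¬ (∃ σ, (B.psi v x).1 = side σ) ∧ ∃ σ, x.1 = side σ) ∨
      (¬ (∃ σ, (B.psi v x).2 = side σ) ∧ ∃ σ, x.2 = side σ) := by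
    rcases CarpetSystem.meet_cases (S := S) hvw hx hy (congrArg Prod.fst h)
      (congrArg Prod.snd h) with ⟨σ, hn, e, -⟩ | ⟨σ, hn, e, -⟩ | ⟨σ, τ, hn, e, -⟩
    · exact Or.inl ⟨fun ⟨ρ, e'⟩ => S.X.g_ne_side (ρ := ρ) hn.1 (e ▸ e'), σ, e⟩
    · exact Or.inr ⟨fun ⟨ρ, e'⟩ => S.Y.g_ne_side (ρ := ρ) hn.1 (e ▸ e'), σ, e⟩
    · exact Or.inl ⟨fun ⟨ρ, e'⟩ => S.X.g_ne_side (ρ := ρ) hn.1 (e ▸ e'), σ, e⟩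
  unfold endCount
  rcases h3 with ⟨h3, h4⟩ | ⟨h3, h4⟩
  · rw [if_neg h3, if_pos h4]
    split_ifs <;> first | omega | exact absurd (h2 ‹_›) ‹_›
  · rw [if_neg h3, if_pos h4]
    split_ifs <;> first | omega | exact absurd (h1 ‹_›) ‹_›

theorem endCount_le (hconn : IsConnected B.carpet) (v : B.D) {x : ℝ × ℝ} (hx : x ∈ B.carpet) :
    endCount (B.psi v x) ≤ endCount x := by
  let S := B.system hconn
  have h1 : (∃ σ, (B.psi v x).1 = side σ) → ∃ σ, x.1 = side σ := fun ⟨σ, e⟩ =>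
    ⟨σ, (S.X.eq_side_of_g (w := v) (S.mem_left hx) e).2⟩
  have h2 : (∃ σ, (B.psi v x).2 = side σ) → ∃ σ, x.2 = side σ := fun ⟨σ, e⟩ =>
    ⟨σ, (S.Y.eq_side_of_g (w := v) (S.mem_right hx) e).2⟩
  unfold endCount
  split_ifs <;> simp_all

/-- No point at which the carpet can be split has more coordinates `0` or `1` than `x`. -/
def Extremal (B : BaranskiData) (x : ℝ × ℝ) : Prop :=
  ∀ y E F, B.IsSplit y E F → endCount y ≤ endCount x

theorem exists_extremal (h : ∃ x E F, B.IsSplit x E F) :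
    ∃ x E F, B.IsSplit x E F ∧ B.Extremal x := by
  let s : Set ℕ := {n | ∃ x E F, B.IsSplit x E F ∧ endCount x = n}
  have hne : s.Nonempty := by
    obtain ⟨x, E, F, h⟩ := h
    exact ⟨_, x, E, F, h, rfl⟩
  have hb : BddAbove s := ⟨2, by
    rintro _ ⟨x, -, -, -, rfl⟩
    exact endCount_le_two x⟩
  obtain ⟨x, E, F, hx, e⟩ := Nat.sSup_mem hne hb
  exact ⟨x, E, F, hx, fun y E' F' hy => e ▸ le_csSup hb ⟨y, E', F', hy, rfl⟩⟩

/-- The splitting of `K` at the extremal point `x = ψ_v(x')` restricts to a splitting of the cell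
`v`, and all other cells lie on one side and do not contain `x`. -/
def Refines (B : BaranskiData) (x : ℝ × ℝ) (E F : Set (ℝ × ℝ)) (v : B.D) (x' : ℝ × ℝ) : Prop :=
  B.IsSplit x E F ∧ B.psi v x' = x ∧ B.IsSplit x' (B.pull v E) (B.pull v F) ∧ B.Extremal x' ∧
    ∀ w, w ≠ v → x ∉ B.psi w '' B.carpet ∧ (B.psi w '' B.carpet ⊆ E ∨ B.psi w '' B.carpet ⊆ F)

theorem Refines.symm {x : ℝ × ℝ} {E F : Set (ℝ × ℝ)} {v : B.D} {x' : ℝ × ℝ}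
    (h : B.Refines x E F v x') : B.Refines x F E v x' :=
  ⟨h.1.symm, h.2.1, h.2.2.1.symm, h.2.2.2.1, fun w hw =>
    ⟨(h.2.2.2.2 w hw).1, (h.2.2.2.2 w hw).2.symm⟩⟩

/-- If no cell were split, the cells inside `E` would form a pinched partition. A split cell gives a
split point `x'` with at least as many endpoint coordinates as `x`, so `x'` is extremal too; if `x`
lay in a second cell there would be strictly more, against extremality. Hence no second cell
contains `x` or is split. -/
theorem IsSplit.exists_refines (hconn : IsConnected B.carpet)
    (hno : ¬ ∃ A x y, (B.system hconn).Pinched A x y) {x : ℝ × ℝ} {E F : Set (ℝ × ℝ)}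
    (h : B.IsSplit x E F) (hx : B.Extremal x) : ∃ v x', B.Refines x E F v x' := by
  have hsp : ∃ v x', B.psi v x' = x ∧ B.IsSplit x' (B.pull v E) (B.pull v F) := by
    by_contra! hcon
    have hcases : ∀ w, B.psi w '' B.carpet ⊆ E ∨ B.psi w '' B.carpet ⊆ F := fun w =>
      (h.cell_cases hconn w).imp_right fun h' => h'.resolve_right fun ⟨x', h1, h2⟩ =>
        hcon w x' h1 h2
    obtain ⟨-, hE, hF, hEF, hi, ⟨e, he, hex⟩, ⟨f, hf, hfx⟩⟩ := h
    refine hno ⟨{w | B.psi w '' B.carpet ⊆ E}, x.1, x.2, ?_, ?_, ?_⟩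
    · obtain ⟨w, y, hy, rfl⟩ := B.mem_carpet_iff.1 (hEF.le (Or.inl he))
      refine ⟨w, (hcases w).resolve_right fun h => hex (hi ⟨he, h ⟨y, hy, rfl⟩⟩)⟩
    · obtain ⟨w, y, hy, rfl⟩ := B.mem_carpet_iff.1 (hEF.le (Or.inr hf))
      exact ⟨w, fun h => hfx (hi ⟨h ⟨y, hy, rfl⟩, hf⟩)⟩
    · intro v hv w hw x' y' hc hc'
      rw [cell_iff] at hc hc'
      have := hi ⟨hv hc, (hcases w).resolve_left hw hc'⟩
      exact ⟨congrArg Prod.fst this, congrArg Prod.snd this⟩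
  obtain ⟨v, x', rfl, hs⟩ := hsp
  have hle := endCount_le hconn v hs.1
  have hout : ∀ w, w ≠ v → B.psi v x' ∉ B.psi w '' B.carpet := by
    rintro w hw ⟨y, hy, e⟩
    exact absurd (endCount_lt hconn hw.symm hs.1 hy e.symm) (Nat.not_lt.2 (hx _ _ _ hs))
  refine ⟨v, x', h, rfl, hs, fun y E F hy => (hx y E F hy).trans hle, fun w hw => ⟨hout w hw, ?_⟩⟩
  refine (h.cell_cases hconn w).imp_right fun h' => h'.resolve_right ?_
  rintro ⟨z, hz, hz'⟩
  exact hout w hw ⟨z, hz'.1, hz⟩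

theorem IsSplit.exists_word (hconn : IsConnected B.carpet)
    (hno : ¬ ∃ A x y, (B.system hconn).Pinched A x y) (k : ℕ) {x : ℝ × ℝ} {E F : Set (ℝ × ℝ)}
    (h : B.IsSplit x E F) (hx : B.Extremal x) :
    ∃ u : Fin k → B.D, ∀ w, w ≠ u → x ∉ B.cyl w ∧ (B.cyl w ⊆ E ∨ B.cyl w ⊆ F) := by
  induction k generalizing x E F with
  | zero => exact ⟨Fin.elim0, fun w hw => absurd (Subsingleton.elim _ _) hw⟩
  | succ k ih =>
    obtain ⟨v, x', -, rfl, h1, h2, h3⟩ := h.exists_refines hconn hno hx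
    obtain ⟨u, hu⟩ := ih h1 h2
    refine ⟨Fin.cons v u, fun w hw => ?_⟩
    by_cases hwv : w 0 = v
    · obtain ⟨h4, h5⟩ := hu (Fin.tail w) fun e => hw (by rw [← Fin.cons_self_tail w, hwv, e])
      rw [cyl_succ, hwv]
      refine ⟨?_, h5.imp ?_ ?_⟩
      · rintro ⟨y, hy, e⟩
        exact h4 (B.psi_injective v e ▸ hy)
      · rintro h5 _ ⟨y, hy, rfl⟩
        exact (h5 hy).1
      · rintro h5 _ ⟨y, hy, rfl⟩
        exact (h5 hy).1
    · have hsub := B.cyl_subset_psi w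
      obtain ⟨h4, h5⟩ := h3 _ hwv
      exact ⟨fun h => h4 (hsub h), h5.imp hsub.trans hsub.trans⟩

/-- If the cell of an extremal cut point separates two other cells, then all Hata graphs have cut
vertices that separate two blocks. -/
theorem le_chi_of_balanced (hconn : IsConnected B.carpet)
    (hno : ¬ ∃ A x y, (B.system hconn).Pinched A x y) {x x' : ℝ × ℝ} {E F : Set (ℝ × ℝ)}
    {v w w' : B.D} (h : B.Refines x E F v x') (hx : B.Extremal x) (hw : w ≠ v) (hw' : w' ≠ v)
    (hwE : B.psi w '' B.carpet ⊆ E) (hwF : B.psi w' '' B.carpet ⊆ F) (k : ℕ) :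
    B.D.card ^ k ≤ (B.hataGraph (k + 1)).chi := by
  obtain ⟨u, hu⟩ := h.1.exists_word hconn hno (k + 1) hx
  obtain ⟨hs, -, -, -, hout⟩ := h
  have hxu : x ∈ B.cyl u := by
    obtain ⟨u', hu'⟩ := B.exists_mem_cyl (k + 1) hs.1
    by_cases e : u' = u
    · exact e ▸ hu'
    · exact absurd hu' (hu u' e).1
  have hu0 : u 0 = v := by
    by_contra h0
    exact (hout _ h0).1 (B.cyl_subset_psi u hxu)
  have hi := hs.2.2.2.2.1
  refine le_chi_of_blocks hconn (v := u) (P := fun a => B.cyl a ⊆ E) (d := w) (d' := w') ?_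
    (hu0 ▸ hw.symm) (hu0 ▸ hw'.symm) ?_ ?_
  · intro a b ha hb hab haE
    refine (hu b hb).2.resolve_right fun hbF => ?_
    obtain ⟨z, hz, hz'⟩ := hab.2
    obtain rfl : z = x := hi ⟨haE hz, hbF hz'⟩
    exact (hu a ha).1 hz
  · intro a ha
    rw [mem_block] at ha
    exact (B.cyl_subset_psi a).trans (ha ▸ hwE)
  · intro a ha haE
    rw [mem_block] at ha
    obtain ⟨z, hz⟩ := B.cyl_nonempty a
    obtain rfl : z = x := hi ⟨haE hz, hwF (ha ▸ B.cyl_subset_psi a hz)⟩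
    exact (hu a (by rintro rfl; exact hw' (ha.symm.trans hu0))).1 hz

/-! ### Unbalanced splittings are impossible -/

theorem IsSplit.exists_cyl_subset {x : ℝ × ℝ} {E F : Set (ℝ × ℝ)} (h : B.IsSplit x E F) :
    ∃ m, ∃ u : Fin m → B.D, B.cyl u ⊆ E := by
  obtain ⟨-, hE, hF, hEF, hi, ⟨e, he, hex⟩, -⟩ := h
  have heF : e ∈ Fᶜ := fun h => hex (hi ⟨he, h⟩)
  obtain ⟨ε, hε, hball⟩ := Metric.isOpen_iff.1 hF.isOpen_compl e heF
  obtain ⟨m, hm⟩ := B.exists_cyl_small hε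
  obtain ⟨u, hu⟩ := B.exists_mem_cyl m (hEF.le (Or.inl he))
  refine ⟨m, u, fun y hy => ?_⟩
  exact (hEF.ge (B.cyl_subset u hy)).resolve_right (hball (hm m le_rfl u y hy e hu))

theorem exists_ne_mem_cyl (hconn : IsConnected B.carpet) {k : ℕ} (u : Fin k → B.D) (x : ℝ × ℝ) :
    ∃ y ∈ B.cyl u, y ≠ x := by
  obtain ⟨y, hy⟩ := B.carpet_nonempty
  obtain ⟨z, hz, hzy⟩ := B.exists_ne_mem_carpet hconn y
  by_cases h : B.psiWord k u y = x
  · exact ⟨_, ⟨z, hz, rfl⟩, fun h' => hzy (B.psiWord_injective u (h'.trans h.symm))⟩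
  · exact ⟨_, ⟨y, hy, rfl⟩, h⟩

/-- One passes from a splitting all of whose other cells are in `F` to a splitting all of whose
other cells are in `E`, and stays in a cell whose fixed point is in `E`. -/
theorem exists_flip (hconn : IsConnected B.carpet)
    (hno : ¬ ∃ A x y, (B.system hconn).Pinched A x y)
    (hunb : ∀ x E F v x', B.Refines x E F v x' → B.Extremal x →
      (∀ w, w ≠ v → B.psi w '' B.carpet ⊆ E) ∨ ∀ w, w ≠ v → B.psi w '' B.carpet ⊆ F)
    (m : ℕ) {u : Fin m → B.D} {x x' : ℝ × ℝ} {E F : Set (ℝ × ℝ)} {v : B.D} (hu : B.cyl u ⊆ E)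
    (h : B.Refines x E F v x') (hF : ∀ w, w ≠ v → B.psi w '' B.carpet ⊆ F) :
    ∃ y y' y'' E' F' a b, B.Refines y E' F' a y' ∧
      B.Refines y' (B.pull a E') (B.pull a F') b y'' ∧
      (∀ w, w ≠ a → B.psi w '' B.carpet ⊆ F') ∧
      (∀ w, w ≠ b → B.psi w '' B.carpet ⊆ B.pull a E') ∧
      ∀ c z, z ∈ E → z ≠ x → z ∈ B.carpet → B.psi c z = z →
        (∀ w, w ≠ c → z ∉ B.psi w '' B.carpet) → a = c := by
  have hcell : ∀ {x E F v x'}, B.Refines x E F v x' →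
      (∀ w, w ≠ v → B.psi w '' B.carpet ⊆ F) → ∀ c z, z ∈ E → z ≠ x → z ∈ B.carpet →
      B.psi c z = z → (∀ w, w ≠ c → z ∉ B.psi w '' B.carpet) → v = c := by
    intro x E F v x' h hF c z hz hzx hzK hcz _
    by_contra hvc
    exact hzx (h.1.2.2.2.2.1 ⟨hz, hF c (Ne.symm hvc) ⟨z, hzK, hcz⟩⟩)
  induction m generalizing x x' E F v with
  | zero =>
    obtain ⟨-, -, -, hEF, hi, -, ⟨f, hf, hfx⟩⟩ := h.1
    have : B.cyl u = B.carpet := Set.image_id _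
    exact absurd (hi ⟨hu (this ▸ hEF.le (Or.inr hf)), hf⟩) hfx
  | succ m ih =>
    obtain ⟨v', x'', h'⟩ := h.2.2.1.exists_refines hconn hno h.2.2.2.1
    -- Either the side changes here, or one descends into `v`. The cylinder in `E` must then start
    -- with `v`, so its depth drops; at depth 0 it would be all of `K`.
    rcases hunb _ _ _ _ _ h' h.2.2.2.1 with h1 | h1
    · exact ⟨x, x', x'', E, F, v, v', h, h', hF, h1, hcell h hF⟩
    have hu0 : u 0 = v := by
      by_contra h0
      obtain ⟨y, hy, hyx⟩ := exists_ne_mem_cyl hconn u x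
      exact hyx (h.1.2.2.2.2.1 ⟨hu hy, hF _ h0 (B.cyl_subset_psi u hy)⟩)
    have hut : B.cyl (Fin.tail u) ⊆ B.pull v E := by
      refine fun y hy => ⟨hu ?_, B.cyl_subset _ hy⟩
      rw [cyl_succ, hu0]
      exact ⟨y, hy, rfl⟩
    obtain ⟨y, y', y'', E', F', a, b, g1, g2, g3, g4, g5⟩ := ih hut h' h1
    refine ⟨y, y', y'', E', F', a, b, g1, g2, g3, g4, fun c z hz hzx hzK hcz hzc => ?_⟩
    obtain rfl := hcell h hF c z hz hzx hzK hcz hzc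
    refine g5 v z ⟨?_, hzK⟩ ?_ hzK hcz hzc
    · change B.psi v z ∈ E
      rwa [hcz]
    · rintro rfl
      exact hzx (hcz.symm.trans h.2.1)

/-- A contact of `a` lies in `F` because all other cells do. The subcells other than `b` lie in `E`
and meet `F` at most in `x'`, which is not a contact because `x` lies in no cell but `a`. -/
theorem contact_of_flip (hconn : IsConnected B.carpet) {x x' x'' : ℝ × ℝ} {E F : Set (ℝ × ℝ)}
    {a b : B.D} (h : B.Refines x E F a x') (h' : B.Refines x' (B.pull a E) (B.pull a F) b x'')
    (hF : ∀ w, w ≠ a → B.psi w '' B.carpet ⊆ F)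
    (hE : ∀ w, w ≠ b → B.psi w '' B.carpet ⊆ B.pull a E) {p q : ℝ}
    (hpq : (B.system hconn).Contact a p q) :
    (p, q) ∈ B.pull a F ∧ (p, q) ≠ x' ∧ (p, q) ∈ B.psi b '' B.carpet ∧
      ∀ w, w ≠ b → (p, q) ∉ B.psi w '' B.carpet := by
  obtain ⟨hK, w, hw, hc⟩ := hpq
  have hc' : B.psi a (p, q) ∈ B.psi w '' B.carpet := (B.cell_iff hconn).1 hc
  have h1 : (p, q) ∈ B.pull a F := ⟨hF w hw hc', hK⟩
  have h2 : (p, q) ≠ x' := by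
    intro e
    rw [e, h.2.1] at hc'
    exact (h.2.2.2.2 w hw).1 hc'
  have h3 : ∀ w, w ≠ b → (p, q) ∉ B.psi w '' B.carpet := fun w hw hcw =>
    h2 (h'.1.2.2.2.2.1 ⟨hE w hw hcw, h1⟩)
  refine ⟨h1, h2, ?_, h3⟩
  obtain ⟨w, y, hy, e⟩ := B.mem_carpet_iff.1 hK
  by_cases hwb : w = b
  · exact hwb ▸ ⟨y, hy, e⟩
  · exact absurd ⟨y, hy, e⟩ (h3 w hwb)

/-- A carpet without pinched partitions that can be split has a balanced splitting. -/
theorem exists_balanced (hconn : IsConnected B.carpet)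
    (hno : ¬ ∃ A x y, (B.system hconn).Pinched A x y) (hs : ∃ x E F, B.IsSplit x E F) :
    ∃ x E F v x', B.Refines x E F v x' ∧ B.Extremal x ∧
      (∃ w, w ≠ v ∧ B.psi w '' B.carpet ⊆ E) ∧ ∃ w, w ≠ v ∧ B.psi w '' B.carpet ⊆ F := by
  by_contra! hcon
  have hunb : ∀ x E F v x', B.Refines x E F v x' → B.Extremal x →
      (∀ w, w ≠ v → B.psi w '' B.carpet ⊆ E) ∨ ∀ w, w ≠ v → B.psi w '' B.carpet ⊆ F := by
    intro x E F v x' h hx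
    by_cases hE : ∃ w, w ≠ v ∧ B.psi w '' B.carpet ⊆ E
    · exact Or.inl fun w hw => (h.2.2.2.2 w hw).2.resolve_right (hcon x E F v x' h hx hE w hw)
    · push Not at hE
      exact Or.inr fun w hw => (h.2.2.2.2 w hw).2.resolve_left (hE w hw)
  have conf : ∀ {x x' x'' E F a b}, B.Refines x E F a x' →
      B.Refines x' (B.pull a E) (B.pull a F) b x'' →
      (∀ w, w ≠ a → B.psi w '' B.carpet ⊆ F) →
      (∀ w, w ≠ b → B.psi w '' B.carpet ⊆ B.pull a E) → (B.system hconn).Confined a b := by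
    intro x x' x'' E F a b h h' hF hE p q hpq
    obtain ⟨-, -, h1, h2⟩ := contact_of_flip hconn h h' hF hE hpq
    exact ⟨(B.cell_iff hconn).2 h1, fun w hw hc => h2 w hw ((B.cell_iff hconn).1 hc)⟩
  have key : ∀ {x E F v x'}, B.Refines x E F v x' →
      (∀ w, w ≠ v → B.psi w '' B.carpet ⊆ F) → False := by
    intro x E F v x' h hF
    obtain ⟨m, u, hu⟩ := h.1.exists_cyl_subset
    obtain ⟨y, y', y'', E', F', a, b, g1, g2, g3, g4, -⟩ :=
      exists_flip hconn hno hunb m hu h hF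
    obtain ⟨⟨p, q, hpq, hp, hq⟩, hb⟩ := CarpetSystem.Confined.exists_contact_fixed
      B.exists_ne_cell hno (conf g1 g2 g3 g4)
    obtain ⟨k1, k2, k3, k4⟩ := contact_of_flip hconn g1 g2 g3 g4 hpq
    obtain ⟨m', u', hu'⟩ := g2.symm.1.exists_cyl_subset
    obtain ⟨z, z', z'', E'', F'', a', b', l1, l2, l3, l4, l5⟩ :=
      -- The second flip starts at the split point in `a` with the roles of `E` and `F` exchanged.
      -- The fixed point of `b` is a contact of `a`, hence on the side being followed, so the flip
      -- happens in the cell `b` and confines it.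
      exists_flip hconn hno hunb m' hu' g2.symm g4
    obtain rfl := l5 b (p, q) k1 k2 k1.2 (Prod.ext hp hq) k4
    exact hb b' (conf l1 l2 l3 l4)
  obtain ⟨x, E, F, hs, hx⟩ := exists_extremal hs
  obtain ⟨v, x', h⟩ := hs.exists_refines hconn hno hx
  rcases hunb x E F v x' h hx with h1 | h1
  · exact key h.symm h1
  · exact key h h1

/-- If the carpet has a cut point, then its Hata graphs have cut vertices with two large
components. -/
theorem le_chi_of_isCutPoint (hconn : IsConnected B.carpet) {x : ℝ × ℝ}
    (hx : IsCutPoint B.carpet x) (k : ℕ) : B.D.card ^ k - 1 ≤ (B.hataGraph (k + 1)).chi := by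
  by_cases hno : ∃ A x y, (B.system hconn).Pinched A x y
  · obtain ⟨A, x, y, h⟩ := hno
    rcases h.exists_isTail_or with ⟨v, e, h⟩ | ⟨A, x, y, v, h, w, hw, hwv⟩
    · exact le_chi_of_isTail hconn h k
    · exact (Nat.sub_le _ _).trans (le_chi_of_pinchedAt hconn h hw hwv k)
  · obtain ⟨E, F, hs⟩ := exists_isSplit_of_isCutPoint hx
    obtain ⟨x, E, F, v, x', h, hx, ⟨w, hw, hwE⟩, w', hw', hwF⟩ :=
      exists_balanced hconn hno ⟨x, E, F, hs⟩
    exact (Nat.sub_le _ _).trans (le_chi_of_balanced hconn hno h hx hw hw' hwE hwF k)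

end BaranskiData

namespace BaranskiData

variable {B : BaranskiData}

/-! ### From cut vertices to a cut point -/

/-- A large union of components of `Γ - {v}` contains all words with some two-letter prefix. -/
theorem exists_prefix_of_le_ncard (hconn : IsConnected B.carpet) {j : ℕ}
    {v : Fin (j + 2) → B.D} {C : Set (Fin (j + 2) → B.D)} (hv : v ∉ C)
    (hC : (B.hataGraph (j + 2)).InvariantOff v (· ∈ C)) (hcard : B.D.card ^ (j + 1) - 1 ≤ C.ncard) :
    ∃ a b : B.D, ∀ u : Fin j → B.D,
      (Fin.cons a (Fin.cons b u : Fin (j + 1) → B.D) : Fin (j + 2) → B.D) ∈ C := by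
  have hinj : ∀ a b : B.D, Function.Injective fun u : Fin j → B.D =>
      (Fin.cons a (Fin.cons b u : Fin (j + 1) → B.D) : Fin (j + 2) → B.D) := fun a b =>
    (Fin.cons_right_injective (α := fun _ => B.D) a).comp
      (Fin.cons_right_injective (α := fun _ => B.D) b)
  -- If all words of `C` shared the two-letter prefix of `v`, there would be at most `|D|^j - 1` of
  -- them. A single letter would not do: the block of `v 0` without `v` has exactly `|D|^(j+1) - 1`
  -- words.
  have hex : ∃ w ∈ C, ¬ (w 0 = v 0 ∧ w 1 = v 1) := by
    by_contra! hall
    have hcons : ∀ w : Fin (j + 2) → B.D,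
        w = Fin.cons (w 0) (Fin.cons (w 1) (Fin.tail (Fin.tail w)) : Fin (j + 1) → B.D) := by
      intro w
      have : w 1 = Fin.tail w 0 := rfl
      rw [this, Fin.cons_self_tail, Fin.cons_self_tail]
    have hsub : C ⊆ (fun u : Fin j → B.D =>
        (Fin.cons (v 0) (Fin.cons (v 1) u : Fin (j + 1) → B.D) : Fin (j + 2) → B.D)) ''
          {Fin.tail (Fin.tail v)}ᶜ := by
      intro w hw
      obtain ⟨h0, h1⟩ := hall w hw
      refine ⟨Fin.tail (Fin.tail w), fun h => hv ?_, ?_⟩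
      · rwa [hcons w, h0, h1, (h : Fin.tail (Fin.tail w) = _), ← hcons v] at hw
      · change Fin.cons _ (Fin.cons _ _) = _
        rw [← h0, ← h1, ← hcons w]
    have := hcard.trans (Set.ncard_le_ncard hsub (Set.toFinite _))
    rw [Set.ncard_image_of_injective _ (hinj _ _), Set.ncard_compl, Set.ncard_singleton,
      ncard_words, pow_succ] at this
    have h1 := B.one_lt_card
    have h2 : 0 < B.D.card ^ j := pow_pos (by omega) j
    have : B.D.card ^ j * 2 ≤ B.D.card ^ j * B.D.card := Nat.mul_le_mul_left _ h1
    omega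
  obtain ⟨w, hw, hne⟩ := hex
  refine ⟨w 0, w 1, fun u => ?_⟩
  have hcv : ∀ u : Fin j → B.D,
      (Fin.cons (w 0) (Fin.cons (w 1) u : Fin (j + 1) → B.D) : Fin (j + 2) → B.D) ≠ v := by
    rintro u rfl
    exact hne ⟨rfl, rfl⟩
  refine hataGraph_invariant hconn (P := fun u : Fin j → B.D =>
    (Fin.cons (w 0) (Fin.cons (w 1) u : Fin (j + 1) → B.D) : Fin (j + 2) → B.D) ∈ C)
    (fun a b hab => hC _ _ (hcv a) (hcv b) (hataGraph_adj_cons _ (hataGraph_adj_cons _ hab)))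
    (a := Fin.tail (Fin.tail w)) ?_
  have : w 1 = Fin.tail w 0 := rfl
  rwa [this, Fin.cons_self_tail, Fin.cons_self_tail]

theorem mem_cyl_cons_cons {j : ℕ} (a b : B.D) {x : ℝ × ℝ}
    (hx : x ∈ B.psi a '' (B.psi b '' B.carpet)) :
    ∃ u : Fin j → B.D,
      x ∈ B.cyl (Fin.cons a (Fin.cons b u : Fin (j + 1) → B.D) : Fin (j + 2) → B.D) := by
  obtain ⟨_, ⟨y, hy, rfl⟩, rfl⟩ := hx
  obtain ⟨u, hu⟩ := B.exists_mem_cyl j hy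
  refine ⟨u, ?_⟩
  rw [cyl_cons, cyl_cons]
  exact ⟨_, ⟨y, hu, rfl⟩, rfl⟩

theorem exists_ne_mem_psi_psi (hconn : IsConnected B.carpet) (a b : B.D) (x : ℝ × ℝ) :
    ∃ y ∈ B.psi a '' (B.psi b '' B.carpet), y ≠ x := by
  obtain ⟨y, hy⟩ := B.carpet_nonempty
  obtain ⟨z, hz, hzy⟩ := B.exists_ne_mem_carpet hconn y
  by_cases h : B.psi a (B.psi b y) = x
  · exact ⟨_, ⟨_, ⟨z, hz, rfl⟩, rfl⟩, fun h' =>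
      hzy (B.psi_injective b (B.psi_injective a (h'.trans h.symm)))⟩
  · exact ⟨_, ⟨_, ⟨y, hy, rfl⟩, rfl⟩, h⟩

/-- The union of the cylinders of the words in `C`. -/
def cylUnion (B : BaranskiData) {k : ℕ} (C : Set (Fin k → B.D)) : Set (ℝ × ℝ) := ⋃ u ∈ C, B.cyl u

theorem mem_cylUnion {k : ℕ} {C : Set (Fin k → B.D)} {x : ℝ × ℝ} :
    x ∈ B.cylUnion C ↔ ∃ u ∈ C, x ∈ B.cyl u := by
  simp [cylUnion]

theorem isClosed_cylUnion {k : ℕ} (C : Set (Fin k → B.D)) : IsClosed (B.cylUnion C) :=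
  (Set.toFinite C).isClosed_biUnion fun u _ => (B.isCompact_cyl u).isClosed

theorem disjoint_cylUnion {k : ℕ} {v : Fin k → B.D} {C : Set (Fin k → B.D)} (hv : v ∉ C)
    (hC : (B.hataGraph k).InvariantOff v (· ∈ C)) {x : ℝ × ℝ} (hx : x ∈ B.cylUnion C)
    {u : Fin k → B.D} (hu : u ∉ C) (huv : u ≠ v) : x ∉ B.cyl u := by
  intro hxu
  obtain ⟨w, hw, hxw⟩ := mem_cylUnion.1 hx
  exact hu (hC w u (fun e => hv (e ▸ hw)) huv ⟨fun e => hu (e ▸ hw), x, hxw, hxu⟩ hw)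

/-- A cylinder that does not meet the cylinder of the removed vertex lies on one side. -/
theorem mem_cylUnion_iff_of_mem_cyl (hconn : IsConnected B.carpet) {k m : ℕ} {v : Fin k → B.D}
    {C : Set (Fin k → B.D)} (hv : v ∉ C) (hC : (B.hataGraph k).InvariantOff v (· ∈ C))
    {w : Fin m → B.D} (hw : ∀ x ∈ B.cyl w, x ∉ B.cyl v) {x y : ℝ × ℝ} (hx : x ∈ B.cyl w)
    (hy : y ∈ B.cyl w) (hxC : x ∈ B.cylUnion C) : y ∈ B.cylUnion C := by
  have hpre : IsPreconnected (B.cyl w) :=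
    hconn.isPreconnected.image _ (B.psiWord_continuous w).continuousOn
  have hcov : ∀ z ∈ B.cyl w, z ∈ B.cylUnion C ∨ z ∈ B.cylUnion {u | u ∉ C ∧ u ≠ v} := by
    intro z hz
    obtain ⟨u, hu⟩ := B.exists_mem_cyl k (B.cyl_subset w hz)
    have huv : u ≠ v := fun e => hw z hz (e ▸ hu)
    by_cases huC : u ∈ C
    · exact Or.inl (mem_cylUnion.2 ⟨u, huC, hu⟩)
    · exact Or.inr (mem_cylUnion.2 ⟨u, ⟨huC, huv⟩, hu⟩)
  refine (hcov y hy).resolve_right fun hy' => ?_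
  obtain ⟨z, -, hz, hz'⟩ := isPreconnected_closed_iff.1 hpre _ _ (isClosed_cylUnion C)
    (isClosed_cylUnion {u | u ∉ C ∧ u ≠ v}) hcov ⟨x, hx, hxC⟩ ⟨y, hy, hy'⟩
  obtain ⟨u, hu, hzu⟩ := mem_cylUnion.1 hz'
  exact disjoint_cylUnion hv hC hz hu.1 hu.2 hzu

theorem exists_eventually_eq {α : Type*} [Finite α] (U : Ultrafilter ℕ) (f : ℕ → α) :
    ∃ a, ∀ᶠ j in U, f j = a := by
  obtain ⟨a, ha⟩ := Ultrafilter.eq_pure_of_finite (U.map f)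
  refine ⟨a, ?_⟩
  have : ∀ᶠ b in (U.map f : Filter α), b = a := by
    rw [ha]
    exact rfl
  exact this

/-- If all Hata graphs have cut vertices with two large components, then the carpet has a cut
point. -/
theorem exists_isCutPoint_of_le_chi (hconn : IsConnected B.carpet)
    (h : ∀ j, B.D.card ^ (j + 1) - 1 ≤ (B.hataGraph (j + 2)).chi) :
    ∃ x, IsCutPoint B.carpet x := by
  have hpos : ∀ j, 0 < B.D.card ^ (j + 1) - 1 := fun j => by
    have : 1 < B.D.card ^ (j + 1) := Nat.one_lt_pow (Nat.succ_ne_zero j) B.one_lt_card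
    omega
  choose v C C' hdisj hvC hvC' hC hC' hcard hcard' using fun j =>
    SimpleGraph.exists_invariantOff_of_le_chi (hpos j) (h j)
  choose a b hab using fun j => exists_prefix_of_le_ncard hconn (hvC j) (hC j) (hcard j)
  choose a' b' hab' using fun j => exists_prefix_of_le_ncard hconn (hvC' j) (hC' j) (hcard' j)
  -- One ultrafilter fixes all limits at once: the four prefix letters, the limit `x` of the cut
  -- cylinders, and the side of each point.
  let U : Ultrafilter ℕ := Filter.hyperfilter ℕ
  have hUtop : (U : Filter ℕ) ≤ Filter.atTop := Nat.hyperfilter_le_atTop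
  obtain ⟨d, hd⟩ := exists_eventually_eq U a
  obtain ⟨e, he⟩ := exists_eventually_eq U b
  obtain ⟨d', hd'⟩ := exists_eventually_eq U a'
  obtain ⟨e', he'⟩ := exists_eventually_eq U b'
  obtain ⟨x₀, hx₀⟩ := B.carpet_nonempty
  obtain ⟨x, hxK, hx⟩ := isCompact_iff_ultrafilter_le_nhds.1 B.isCompact_carpet
    (U.map fun j => B.psiWord (j + 2) (v j) x₀) (by
      rw [Filter.le_principal_iff]
      exact Filter.mem_map.2 (Filter.Eventually.of_forall fun j => B.psiWord_mem (v j) hx₀))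
  have hnear : ∀ ε > 0, ∀ᶠ j in U, ∀ y ∈ B.cyl (v j), dist y x < ε := by
    intro ε hε
    obtain ⟨m, hm⟩ := B.exists_cyl_small (half_pos hε)
    have h1 : ∀ᶠ j in U, B.psiWord (j + 2) (v j) x₀ ∈ Metric.ball x (ε / 2) :=
      hx (Metric.ball_mem_nhds x (half_pos hε))
    filter_upwards [h1, hUtop (Filter.eventually_ge_atTop m)] with j hj hjm y hy
    have h2 := hm (j + 2) (by omega) (v j) y hy _ ⟨x₀, hx₀, rfl⟩
    have h3 := dist_triangle y (B.psiWord (j + 2) (v j) x₀) x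
    rw [Metric.mem_ball] at hj
    linarith
  have hlocal : ∀ y ∈ B.carpet, y ≠ x → ∃ O, IsOpen O ∧ y ∈ O ∧ ∀ z ∈ O, z ∈ B.carpet →
      ∀ᶠ j in U, (y ∈ B.cylUnion (C j) ↔ z ∈ B.cylUnion (C j)) := by
    intro y hy hyx
    have hε := half_pos (dist_pos.2 hyx)
    obtain ⟨m, hm⟩ := B.exists_cyl_small hε
    -- Each point of `K` in this neighbourhood shares with `y` a cylinder of level `m`. Its diameter
    -- is below half the distance from `y` to `x`, so eventually it avoids the cylinder of the cut
    -- vertex and lies on one side.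
    refine ⟨(B.cylUnion {w : Fin m → B.D | y ∉ B.cyl w})ᶜ, (isClosed_cylUnion _).isOpen_compl,
      fun h => ?_, fun z hz hzK => ?_⟩
    · obtain ⟨w, hw, hyw⟩ := mem_cylUnion.1 h
      exact hw hyw
    · obtain ⟨w, hw⟩ := B.exists_mem_cyl m hzK
      have hyw : y ∈ B.cyl w := by
        by_contra hyw
        exact hz (mem_cylUnion.2 ⟨w, hyw, hw⟩)
      filter_upwards [hnear _ hε] with j hj
      have hoff : ∀ t ∈ B.cyl w, t ∉ B.cyl (v j) := by
        intro t ht htv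
        have h1 := hm m le_rfl w y hyw t ht
        have h2 := hj t htv
        have h3 := dist_triangle y t x
        linarith
      exact ⟨mem_cylUnion_iff_of_mem_cyl hconn (hvC j) (hC j) hoff hyw hw,
        mem_cylUnion_iff_of_mem_cyl hconn (hvC j) (hC j) hoff hw hyw⟩
  choose! O hO hyO hOC using hlocal
  -- The limit of the components: locally constant on `K \ {x}`, it contains the cells with prefix
  -- `d e` and misses those with prefix `d' e'`, apart from `x`.
  let A : Set (ℝ × ℝ) := {y | ∀ᶠ j in U, y ∈ B.cylUnion (C j)}
  have hA : ∀ y ∈ B.carpet, y ≠ x → ∀ z ∈ O y, z ∈ B.carpet → (y ∈ A ↔ z ∈ A) := by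
    intro y hy hyx z hz hzK
    exact Filter.eventually_congr (hOC y hy hyx z hz hzK)
  refine ⟨x, hxK, fun hpre => ?_⟩
  obtain ⟨y, hy, hyx⟩ := exists_ne_mem_psi_psi hconn d e x
  obtain ⟨y', hy', hyx'⟩ := exists_ne_mem_psi_psi hconn d' e' x
  have hK : ∀ {d e : B.D}, B.psi d '' (B.psi e '' B.carpet) ⊆ B.carpet := by
    rintro d e _ ⟨_, ⟨y, hy, rfl⟩, rfl⟩
    exact B.psi_mem d (B.psi_mem e hy)
  have hyA : y ∈ A := by
    filter_upwards [hd, he] with j h1 h2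
    obtain ⟨u, hu⟩ := mem_cyl_cons_cons (j := j) d e hy
    exact mem_cylUnion.2 ⟨_, by rw [← h1, ← h2]; exact hab j u, hu⟩
  have hyA' : y' ∉ A := by
    intro hA
    obtain ⟨j, h1, h2, h3⟩ := (hd'.and (he'.and hA)).exists
    obtain ⟨u, hu⟩ := mem_cyl_cons_cons (j := j) d' e' hy'
    have hmem : (Fin.cons d' (Fin.cons e' u : Fin (j + 1) → B.D) : Fin (j + 2) → B.D) ∈ C' j := by
      rw [← h1, ← h2]
      exact hab' j u
    exact disjoint_cylUnion (hvC j) (hC j) h3 (fun h => Set.disjoint_left.1 (hdisj j) h hmem)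
      (fun h => hvC' j (h ▸ hmem)) hu
  obtain ⟨z, ⟨hzK, -⟩, hz1, hz2⟩ := hpre
    (⋃ y ∈ {y | y ∈ B.carpet ∧ y ≠ x ∧ y ∈ A}, O y)
    (⋃ y ∈ {y | y ∈ B.carpet ∧ y ≠ x ∧ y ∉ A}, O y)
    (isOpen_biUnion fun y hy => hO y hy.1 hy.2.1) (isOpen_biUnion fun y hy => hO y hy.1 hy.2.1)
    (fun y hy => by
      by_cases hyA : y ∈ A
      · exact Or.inl (Set.mem_biUnion (show y ∈ {y | _ ∧ _ ∧ _} from ⟨hy.1, hy.2, hyA⟩)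
          (hyO y hy.1 hy.2))
      · exact Or.inr (Set.mem_biUnion (show y ∈ {y | _ ∧ _ ∧ _} from ⟨hy.1, hy.2, hyA⟩)
          (hyO y hy.1 hy.2)))
    ⟨y, ⟨hK hy, hyx⟩, Set.mem_biUnion (show y ∈ {y | _ ∧ _ ∧ _} from ⟨hK hy, hyx, hyA⟩)
      (hyO y (hK hy) hyx)⟩
    ⟨y', ⟨hK hy', hyx'⟩, Set.mem_biUnion (show y' ∈ {y | _ ∧ _ ∧ _} from ⟨hK hy', hyx', hyA'⟩)
      (hyO y' (hK hy') hyx')⟩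
  simp only [Set.mem_iUnion] at hz1 hz2
  obtain ⟨s, ⟨hsK, hsx, hsA⟩, hzs⟩ := hz1
  obtain ⟨t, ⟨htK, htx, htA⟩, hzt⟩ := hz2
  exact htA ((hA t htK htx z hzt hzK).2 ((hA s hsK hsx z hzs hzK).1 hsA))

end BaranskiData

theorem mainTheorem10 (B : BaranskiData) (hconn : IsConnected B.carpet) :
    (∃ x, IsCutPoint B.carpet x) ↔
      ∀ k : ℕ, 2 ≤ k → (B.D.card : ℤ) ^ (k - 1) - 1 ≤ ((B.hataGraph k).chi : ℤ) := by
  constructor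
  · rintro ⟨x, hx⟩ k hk
    obtain ⟨k, rfl⟩ : ∃ j, k = j + 1 := ⟨k - 1, by omega⟩
    have := BaranskiData.le_chi_of_isCutPoint hconn hx k
    rw [Nat.add_sub_cancel]
    have h1 : ((B.D.card ^ k : ℕ) : ℤ) = (B.D.card : ℤ) ^ k := by push_cast; rfl
    omega
  · intro h
    refine BaranskiData.exists_isCutPoint_of_le_chi hconn fun j => ?_
    have := h (j + 2) (by omega)
    rw [show j + 2 - 1 = j + 1 by omega] at this
    have h1 : ((B.D.card ^ (j + 1) : ℕ) : ℤ) = (B.D.card : ℤ) ^ (j + 1) := by push_cast; rfl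
    omega
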